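/- Let $\mathscr H$ be a complex Hilbert space, $L$ a bounded operator on $\mathscr H$, $H_c(t)$, $t\ge 0$, a norm-continuous family of bounded self-adjoint operators (the control Hamiltonian), $\psi\in\mathscr H$ a unit vector, and $\gamma_\theta\ge 0$ a rate depending on a real parameter, with $\theta\mapsto\sqrt{\gamma_\theta}$ differentiable at the given $\theta$. Let $\rho(t)$, $t\ge 0$, be the solution of the Lindblad equation $$\partial_t\rho=-i[H_c(t),\rho]+\mathscr D_\theta(\rho),\qquad \mathscr D_\theta(\rho)=\gamma_\theta\Bigl(L\rho L^\dagger-\tfrac12\{L^\dagger L,\rho\}\Bigr),\qquad \rho(0)=|\psi\rangle\langle\psi| .$$ The collisional purification of this evolution at time $t$ with $n$ collisions, each of duration $\Delta t=t/n$, is the state vector $$|\Psi_n(\theta;t)\rangle=U_n(\theta)\cdots U_1(\theta)\,|\psi\rangle\otimes|0,\dots,0\rangle,\qquad U_j(\theta)=e^{-i\Delta t\,H_c(j\Delta t)}\,e^{-i\sqrt{\Delta t}\,\sqrt{\gamma_\theta}\,(L\otimes b_j^\dagger+L^\dagger\otimes b_j)},$$ of the system and $n$ bosonic modes with annihilation operators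 $b_1,\dots,b_n$, prepared in the vacuum. The quantum Fisher information (QFI) of a differentiable family of pure states is $4\bigl(\langle\partial_\theta\Psi|\partial_\theta\Psi\rangle-|\langle\Psi|\partial_\theta\Psi\rangle|^2\bigr)$, and the QFI $F_Q(t)$ of the collisional purification is the limit, for $\Delta t\to0$ with $t=n\Delta t$ fixed, of the QFI of $|\Psi_n(\theta;t)\rangle$. Then, for all $t\ge 0$, the vectors $|\Psi_n(\theta;t)\rangle$ are differentiable in the parameter at $\theta$, the limit $F_Q(t)$ exists, $F_Q$ is differentiable in $t$ (one-sidedly at $t=0$), the trace below converges absolutely, and the QFI flow $\dot F_Q=\partial_tF_Q$ is $$\dot F_Q(t)=4\,(\partial_\theta\sqrt{\gamma_\theta})^2\,\operatorname{Tr}\bigl(L^\dagger L\,\rho(t)\bigr),$$ and $$F_Q(t)=\int_0^t\dot F_Q(s)\,ds=4\,(\partial_\theta\sqrt{\gamma_\theta})^2\int_0^t\operatorname{Tr}\bigl(L^\dagger L\,\rho(s)\bigr)\,ds\;\le\;4t\,(\partial_\theta\sqrt{\gamma_\theta})^2\,\|L\|^2,$$ where $\|\cdot\|$ is the operator (spectral)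 norm. In particular the QFI grows at most linearly in time. -/

import Mathlib

open scoped InnerProductSpace

namespace Collisional

section Exponential

variable {E : Type*} [NormedAddCommGroup E] [InnerProductSpace ℂ E]

/-- `U = exp(-i A)` for an operator `A` that is only defined on a domain `D` (which `A` maps into
itself): on every vector of `D` the norm-convergent exponential series gives the action of `U`. -/
def IsUnitaryExp {D : Submodule ℂ E} (A : Module.End ℂ D) (U : E ≃ₗᵢ[ℂ] E) : Prop :=
  ∀ x : D, HasSum (fun m : ℕ => ((-Complex.I) ^ m / (m.factorial : ℂ)) • ((A ^ m) x : E)) (U x)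

/-- Every vector of the domain is an entire vector of `A`. -/
def EntireVectors {D : Submodule ℂ E} (A : Module.End ℂ D) : Prop :=
  ∀ (x : D) (r : ℝ), Summable fun m : ℕ => r ^ m / (m.factorial : ℝ) * ‖((A ^ m) x : E)‖

variable {D : Submodule ℂ E} {A : Module.End ℂ D}

/-- The exponential series `exp(z A) x` on a vector of the domain. -/
noncomputable def expSeries (A : Module.End ℂ D) (z : ℂ) (x : D) : E :=
  ∑' m : ℕ, (z ^ m / (m.factorial : ℂ)) • ((A ^ m) x : E)

theorem hasSum_expSeries [CompleteSpace E] (hA : EntireVectors A) (z : ℂ) (x : D) :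
    HasSum (fun m : ℕ => (z ^ m / (m.factorial : ℂ)) • ((A ^ m) x : E)) (expSeries A z x) := by
  apply Summable.hasSum
  apply Summable.of_norm
  refine (hA x ‖z‖).congr fun m => ?_
  rw [norm_smul, norm_div, norm_pow, Complex.norm_natCast]

theorem expSeries_comp [CompleteSpace E] (hA : EntireVectors A) {w z : ℂ} (hwz : w + z = 0)
    (x : D) :
    HasSum (fun m : ℕ => (w ^ m / (m.factorial : ℂ)) • expSeries A z ((A ^ m) x)) (x : E) := by
  set f : ℕ × ℕ → E := fun p =>
    (w ^ p.1 / (p.1.factorial : ℂ)) • (z ^ p.2 / (p.2.factorial : ℂ)) • ((A ^ (p.1 + p.2)) x : E)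
    with hf
  have hanti : ∀ N : ℕ, ∀ u v : ℝ, ∑ p ∈ Finset.HasAntidiagonal.antidiagonal N,
      (u ^ p.1 / (p.1.factorial : ℝ)) * (v ^ p.2 / (p.2.factorial : ℝ)) =
        (u + v) ^ N / (N.factorial : ℝ) := by
    intro N u v
    rw [add_pow, Finset.Nat.sum_antidiagonal_eq_sum_range_succ_mk, Finset.sum_div]
    refine Finset.sum_congr rfl fun k hk => ?_
    have hk' : k ≤ N := by simpa [Nat.lt_succ_iff] using hk
    rw [Nat.cast_choose ℝ hk']
    have := Nat.factorial_ne_zero N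
    field_simp
  have hantiC : ∀ N : ℕ, ∑ p ∈ Finset.HasAntidiagonal.antidiagonal N,
      (w ^ p.1 / (p.1.factorial : ℂ)) * (z ^ p.2 / (p.2.factorial : ℂ)) =
        (w + z) ^ N / (N.factorial : ℂ) := by
    intro N
    rw [add_pow, Finset.Nat.sum_antidiagonal_eq_sum_range_succ_mk, Finset.sum_div]
    refine Finset.sum_congr rfl fun k hk => ?_
    have hk' : k ≤ N := by simpa [Nat.lt_succ_iff] using hk
    rw [Nat.cast_choose ℂ hk']
    have := Nat.factorial_ne_zero N
    field_simp
  have hnorm : Summable fun p : ℕ × ℕ => ‖f p‖ := by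
    rw [← Finset.HasAntidiagonal.sigmaAntidiagonalEquivProd.summable_iff]
    refine (summable_sigma_of_nonneg (fun _ => norm_nonneg _)).mpr ?_
    refine ⟨fun N => (hasSum_fintype _).summable, ?_⟩
    refine (hA x (‖w‖ + ‖z‖)).congr fun N => ?_
    rw [tsum_fintype, ← hanti N, Finset.sum_mul, ← Finset.sum_coe_sort (Finset.HasAntidiagonal.antidiagonal N)]
    refine Finset.sum_congr rfl fun p _ => ?_
    have hp : p.1.1 + p.1.2 = N := Finset.HasAntidiagonal.mem_antidiagonal.mp p.2
    simp only [hf, Finset.HasAntidiagonal.sigmaAntidiagonalEquivProd_apply, hp]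
    rw [norm_smul, norm_smul, norm_div, norm_div, norm_pow, norm_pow, Complex.norm_natCast,
      Complex.norm_natCast, mul_assoc]
  have hsum : Summable f := Summable.of_norm hnorm
  have htot : HasSum f (x : E) := by
    have h1 := (Finset.HasAntidiagonal.sigmaAntidiagonalEquivProd (A := ℕ)).hasSum_iff.mpr
      hsum.hasSum
    have h2 := h1.sigma (fun N => hasSum_fintype _)
    have h3 : ∀ N : ℕ, (∑ p : Finset.HasAntidiagonal.antidiagonal N,
        (f ∘ Finset.HasAntidiagonal.sigmaAntidiagonalEquivProd) ⟨N, p⟩) =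
          if N = 0 then (x : E) else 0 := by
      intro N
      have : (∑ p : Finset.HasAntidiagonal.antidiagonal N,
        (f ∘ Finset.HasAntidiagonal.sigmaAntidiagonalEquivProd) ⟨N, p⟩) =
          ((w + z) ^ N / (N.factorial : ℂ)) • ((A ^ N) x : E) := by
        rw [← hantiC N, Finset.sum_smul, ← Finset.sum_coe_sort (Finset.HasAntidiagonal.antidiagonal N)]
        refine Finset.sum_congr rfl fun p _ => ?_
        have hp : p.1.1 + p.1.2 = N := Finset.HasAntidiagonal.mem_antidiagonal.mp p.2
        simp only [hf, Function.comp, Finset.HasAntidiagonal.sigmaAntidiagonalEquivProd_apply, hp]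
        rw [smul_smul]
      rw [this, hwz]
      rcases N with _ | N
      · simp
      · simp
    simp only [h3] at h2
    have h4 := h2.unique (hasSum_ite_eq 0 (x : E))
    rw [← h4]
    exact hsum.hasSum
  refine htot.prod_fiberwise fun m => ?_
  have := (hasSum_expSeries hA z ((A ^ m) x)).const_smul (w ^ m / (m.factorial : ℂ))
  have hfun : (fun k : ℕ => f (m, k)) = fun k : ℕ => (w ^ m / (m.factorial : ℂ)) •
      (z ^ k / (k.factorial : ℂ)) • ((A ^ k) ((A ^ m) x) : E) := by
    funext k
    simp only [hf]
    rw [add_comm m k, pow_add, Module.End.mul_apply]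
  rw [hfun]
  exact this

theorem expSeries_add [CompleteSpace E] (hA : EntireVectors A) (z : ℂ) (x y : D) :
    expSeries A z (x + y) = expSeries A z x + expSeries A z y := by
  refine (hasSum_expSeries hA z (x + y)).unique ?_
  convert (hasSum_expSeries hA z x).add (hasSum_expSeries hA z y) using 2 with m
  simp [smul_add]

theorem expSeries_smul [CompleteSpace E] (hA : EntireVectors A) (z c : ℂ) (x : D) :
    expSeries A z (c • x) = c • expSeries A z x := by
  refine (hasSum_expSeries hA z (c • x)).unique ?_
  convert (hasSum_expSeries hA z x).const_smul c using 2 with m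
  simp [smul_comm c]

/-- A symmetric operator all of whose domain vectors are entire generates a unique unitary. -/
theorem existsUnique_isUnitaryExp [CompleteSpace E] (hD : Dense (D : Set E))
    (hsym : ∀ x y : D, ⟪((A x : D) : E), (y : E)⟫_ℂ = ⟪(x : E), ((A y : D) : E)⟫_ℂ)
    (hA : EntireVectors A) : ∃! U : E ≃ₗᵢ[ℂ] E, IsUnitaryExp A U := by
  have hpow : ∀ (m : ℕ) (x y : D),
      ⟪(((A ^ m) x : D) : E), (y : E)⟫_ℂ = ⟪(x : E), (((A ^ m) y : D) : E)⟫_ℂ := by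
    intro m
    induction m with
    | zero => intro x y; simp
    | succ m ih =>
      intro x y
      rw [pow_succ, Module.End.mul_apply, Module.End.mul_apply, ih, hsym, ← Module.End.mul_apply,
        ← Module.End.mul_apply, ← pow_succ', pow_succ]
  have hswap : ∀ (z : ℂ) (x y : D),
      ⟪expSeries A z x, (y : E)⟫_ℂ = ⟪(x : E), expSeries A (starRingEnd ℂ z) y⟫_ℂ := by
    intro z x y
    have h1 := (hasSum_expSeries hA z x).mapL ((innerSL ℂ (y : E)))
    have h2 := (hasSum_expSeries hA (starRingEnd ℂ z) y).mapL ((innerSL ℂ (x : E)))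
    simp only [innerSL_apply_apply, inner_smul_right] at h1 h2
    rw [← inner_conj_symm]
    refine HasSum.unique (Complex.hasSum_conj'.mpr h1) ?_
    refine Eq.mp (congrArg (fun g => HasSum g _) (funext fun m => ?_)) h2
    rw [map_mul, inner_conj_symm, hpow]
    simp
  have hinner : ∀ (z : ℂ), z + starRingEnd ℂ z = 0 → ∀ x y : D,
      ⟪expSeries A z x, expSeries A z y⟫_ℂ = ⟪(x : E), (y : E)⟫_ℂ := by
    intro z hz x y
    have h1 := (hasSum_expSeries hA z y).mapL (innerSL ℂ (expSeries A z x))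
    have h2 := (expSeries_comp hA hz y).mapL (innerSL ℂ (x : E))
    simp only [innerSL_apply_apply, inner_smul_right, hswap] at h1 h2
    exact h1.unique h2
  let V₀ : ℂ → D →ₗ[ℂ] E := fun z =>
    { toFun := expSeries A z
      map_add' := expSeries_add hA z
      map_smul' := expSeries_smul hA z }
  have hnorm : ∀ z : ℂ, z + starRingEnd ℂ z = 0 → ∀ x : D, ‖V₀ z x‖ = ‖(x : E)‖ := by
    intro z hz x
    have := hinner z hz x x
    rw [@norm_eq_sqrt_re_inner ℂ, @norm_eq_sqrt_re_inner ℂ]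
    exact congrArg (fun c : ℂ => Real.sqrt c.re) this
  have hdr : DenseRange (D.subtypeL) := by
    simpa [DenseRange] using hD
  let V : ℂ → E →L[ℂ] E := fun z => (V₀ z).extendOfNorm D.subtypeL
  have hV : ∀ z : ℂ, z + starRingEnd ℂ z = 0 → ∀ x : D, V z (x : E) = expSeries A z x := by
    intro z hz x
    exact LinearMap.extendOfNorm_eq hdr ⟨1, fun y => by simpa using (hnorm z hz y).le⟩ x
  have hVnorm : ∀ z : ℂ, z + starRingEnd ℂ z = 0 → ∀ x : E, ‖V z x‖ = ‖x‖ := by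
    intro z hz x
    refine hdr.induction_on (p := fun x => ‖V z x‖ = ‖x‖) x ?_ ?_
    · exact isClosed_eq (by fun_prop) (by fun_prop)
    · intro y
      exact (congrArg norm (hV z hz y)).trans (hnorm z hz y)
  have hVV : ∀ w z : ℂ, w + starRingEnd ℂ w = 0 → z + starRingEnd ℂ z = 0 → w + z = 0 →
      ∀ x : E, V z (V w x) = x := by
    intro w z hw hz hwz x
    refine hdr.induction_on (p := fun x => V z (V w x) = x) x ?_ ?_
    · exact isClosed_eq (by fun_prop) (by fun_prop)
    · intro y
      have h1 := (hasSum_expSeries hA w y).mapL (V z)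
      simp only [map_smul, hV z hz] at h1
      change V z (V w (y : E)) = y
      rw [hV w hw]
      exact h1.unique (expSeries_comp hA hwz y)
  have hI : (-Complex.I) + starRingEnd ℂ (-Complex.I) = 0 := by simp
  have hI' : Complex.I + starRingEnd ℂ Complex.I = 0 := by simp
  refine ⟨{ toLinearEquiv := LinearEquiv.ofLinearMap (V (-Complex.I)).toLinearMap
              (V Complex.I).toLinearMap
              (LinearMap.ext fun x => hVV _ _ hI' hI (by simp) x)
              (LinearMap.ext fun x => hVV _ _ hI hI' (by simp) x)
            norm_map' := fun x => hVnorm _ hI x }, ?_, ?_⟩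
  · intro x
    change HasSum _ (V (-Complex.I) (x : E))
    rw [hV _ hI]
    exact hasSum_expSeries hA _ x
  · intro U hU
    ext x
    refine hdr.induction_on (p := fun x => U x = V (-Complex.I) x) x ?_ ?_
    · exact isClosed_eq U.continuous (by fun_prop)
    · intro y
      change U (y : E) = V (-Complex.I) (y : E)
      rw [hV _ hI]
      exact (hU y).unique (hasSum_expSeries hA _ y)

end Exponential
section Chain

variable {H : Type*} [NormedAddCommGroup H]

/-- The joint Hilbert space of the system and a chain of `n` bosonic bath modes,
`H ⊗ ℓ²(ℕ) ⊗ ⋯ ⊗ ℓ²(ℕ)`, in the occupation-number basis of the chain: the value of a vector at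
`k : Fin n → ℕ` is its component in `H ⊗ |k₁, …, kₙ⟩`. -/
abbrev Joint (H : Type*) [NormedAddCommGroup H] (n : ℕ) : Type _ :=
  lp (fun _ : Fin n → ℕ => H) 2

variable {n : ℕ}

/-- Occupation numbers with one more excitation in mode `j`. -/
def up (j : Fin n) (k : Fin n → ℕ) : Fin n → ℕ := Function.update k j (k j + 1)

/-- Occupation numbers with one excitation less in mode `j` (unchanged if there is none). -/
def down (j : Fin n) (k : Fin n → ℕ) : Fin n → ℕ := Function.update k j (k j - 1)

theorem up_self (j : Fin n) (k : Fin n → ℕ) : up j k j = k j + 1 := by simp [up]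

theorem down_self (j : Fin n) (k : Fin n → ℕ) : down j k j = k j - 1 := by simp [down]

theorem down_up (j : Fin n) (k : Fin n → ℕ) : down j (up j k) = k := by simp [up, down]

theorem up_down (j : Fin n) (k : Fin n → ℕ) (h : k j ≠ 0) : up j (down j k) = k := by
  have : k j - 1 + 1 = k j := by omega
  simp [up, down, this]

theorem up_injective (j : Fin n) : Function.Injective (up j) :=
  Function.LeftInverse.injective (down_up j)

theorem eq_zero_of_notMem_range_up (j : Fin n) (k : Fin n → ℕ) (h : k ∉ Set.range (up j)) :
    k j = 0 := by
  by_contra h0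
  exact h ⟨down j k, up_down j k h0⟩

theorem summable_sq (x : Joint H n) : Summable fun k => ‖x k‖ ^ 2 := by
  have := (lp.memℓp x).summable (by norm_num)
  simpa using this

theorem norm_sq_eq (x : Joint H n) : ‖x‖ ^ 2 = ∑' k, ‖x k‖ ^ 2 := by
  have := lp.norm_rpow_eq_tsum (p := 2) (by norm_num) x
  simpa using this

theorem memℓp_two {f : (Fin n → ℕ) → H} (hf : Summable fun k => ‖f k‖ ^ 2) :
    Memℓp (E := fun _ : Fin n → ℕ => H) f 2 :=
  memℓp_gen (by simpa using hf)

variable [InnerProductSpace ℂ H]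

/-- Vectors with at most `M` excitations in mode `j`. -/
def ExcLE (j : Fin n) (M : ℕ) (x : Joint H n) : Prop := ∀ k, M < k j → x k = 0

/-- Vectors with finitely many excitations in mode `j` (and arbitrary in the other modes). -/
def finiteExc (H : Type*) [NormedAddCommGroup H] [InnerProductSpace ℂ H] (j : Fin n) :
    Submodule ℂ (Joint H n) where
  carrier := {x | ∃ M, ExcLE j M x}
  zero_mem' := ⟨0, fun _ _ => rfl⟩
  add_mem' := by
    rintro x y ⟨M, hM⟩ ⟨N, hN⟩
    refine ⟨max M N, fun k hk => ?_⟩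
    rw [lp.coeFn_add, Pi.add_apply, hM k (lt_of_le_of_lt (le_max_left _ _) hk),
      hN k (lt_of_le_of_lt (le_max_right _ _) hk), add_zero]
  smul_mem' := by
    rintro c x ⟨M, hM⟩
    refine ⟨M, fun k hk => ?_⟩
    rw [lp.coeFn_smul, Pi.smul_apply, hM k hk, smul_zero]

theorem dense_finiteExc (j : Fin n) : Dense (finiteExc H j : Set (Joint H n)) := by
  intro x
  have h := lp.hasSum_single (p := 2) (by norm_num) x
  refine mem_closure_of_tendsto h (Filter.Eventually.of_forall fun s => ?_)
  refine Submodule.sum_mem _ fun k _ => ⟨k j, fun k' hk' => ?_⟩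
  refine lp.single_apply_ne (E := fun _ : Fin n → ℕ => H) 2 k (x k) ?_
  rintro rfl
  exact lt_irrefl _ hk'

theorem summable_ann (j : Fin n) {x : Joint H n} {M : ℕ} (hM : ExcLE j M x) :
    Summable (fun k => ‖((√((k j : ℝ) + 1) : ℝ) : ℂ) • x (up j k)‖ ^ 2) ∧
      ∑' k, ‖((√((k j : ℝ) + 1) : ℝ) : ℂ) • x (up j k)‖ ^ 2 ≤ ((M : ℝ) + 1) * ‖x‖ ^ 2 := by
  have hle : ∀ k, ‖((√((k j : ℝ) + 1) : ℝ) : ℂ) • x (up j k)‖ ^ 2 ≤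
      ((M : ℝ) + 1) * ‖x (up j k)‖ ^ 2 := by
    intro k
    rw [norm_smul, mul_pow, Complex.norm_real, Real.norm_eq_abs, sq_abs,
      Real.sq_sqrt (by positivity)]
    by_cases hk : M < up j k j
    · simp [hM _ hk]
    · rw [up_self] at hk
      have : (k j : ℝ) ≤ M := by exact_mod_cast (by omega : k j ≤ M)
      gcongr
  have hs : Summable fun k => ((M : ℝ) + 1) * ‖x (up j k)‖ ^ 2 :=
    ((summable_sq x).comp_injective (up_injective j)).mul_left _
  have hs' := Summable.of_nonneg_of_le (fun k => by positivity) hle hs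
  refine ⟨hs', (hs'.tsum_le_tsum hle hs).trans ?_⟩
  rw [tsum_mul_left, norm_sq_eq]
  refine mul_le_mul_of_nonneg_left ?_ (by positivity)
  exact tsum_comp_le_tsum_of_inj (summable_sq x) (fun _ => by positivity) (up_injective j)

theorem summable_cre (j : Fin n) {x : Joint H n} {M : ℕ} (hM : ExcLE j M x) :
    Summable (fun k => ‖((√(k j : ℝ) : ℝ) : ℂ) • x (down j k)‖ ^ 2) ∧
      ∑' k, ‖((√(k j : ℝ) : ℝ) : ℂ) • x (down j k)‖ ^ 2 ≤ ((M : ℝ) + 1) * ‖x‖ ^ 2 := by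
  set g : (Fin n → ℕ) → ℝ := fun k => ‖((√(k j : ℝ) : ℝ) : ℂ) • x (down j k)‖ ^ 2 with hg
  have h0 : ∀ k ∉ Set.range (up j), g k = 0 := by
    intro k hk
    simp [hg, eq_zero_of_notMem_range_up j k hk]
  have hle : ∀ k, (g ∘ up j) k ≤ ((M : ℝ) + 1) * ‖x k‖ ^ 2 := by
    intro k
    simp only [hg, Function.comp_apply]
    rw [down_up, up_self, norm_smul, mul_pow, Complex.norm_real, Real.norm_eq_abs, sq_abs,
      Real.sq_sqrt (by positivity)]
    by_cases hk : M < k j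
    · simp [hM _ hk]
    · have : (k j : ℝ) ≤ M := by exact_mod_cast (by omega : k j ≤ M)
      push_cast
      gcongr
  have hs : Summable fun k => ((M : ℝ) + 1) * ‖x k‖ ^ 2 := (summable_sq x).mul_left _
  have hs' : Summable (g ∘ up j) :=
    Summable.of_nonneg_of_le (fun k => by simp only [hg, Function.comp_apply]; positivity) hle hs
  refine ⟨((up_injective j).summable_iff h0).mp hs', ?_⟩
  have hsupp : Function.support g ⊆ Set.range (up j) := by
    intro k hk
    by_contra hk'
    exact hk (h0 k hk')
  rw [← (up_injective j).tsum_eq hsupp]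
  refine (hs'.tsum_le_tsum hle hs).trans ?_
  rw [tsum_mul_left, norm_sq_eq]

/-- The annihilation operator `b_j`. -/
noncomputable def annihilation (j : Fin n) : Module.End ℂ (finiteExc H j) where
  toFun x := ⟨⟨fun k => ((√((k j : ℝ) + 1) : ℝ) : ℂ) • x.1 (up j k),
      memℓp_two (summable_ann j x.2.choose_spec).1⟩, by
    obtain ⟨M, hM⟩ := x.2
    refine ⟨M, fun k hk => ?_⟩
    change ((√((k j : ℝ) + 1) : ℝ) : ℂ) • x.1 (up j k) = 0
    rw [hM _ (by rw [up_self]; omega), smul_zero]⟩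
  map_add' x y := by
    ext k
    exact smul_add _ _ _
  map_smul' c x := by
    ext k
    exact smul_comm _ _ _

/-- The creation operator `b_j†`. -/
noncomputable def creation (j : Fin n) : Module.End ℂ (finiteExc H j) where
  toFun x := ⟨⟨fun k => ((√(k j : ℝ) : ℝ) : ℂ) • x.1 (down j k),
      memℓp_two (summable_cre j x.2.choose_spec).1⟩, by
    obtain ⟨M, hM⟩ := x.2
    refine ⟨M + 1, fun k hk => ?_⟩
    change ((√(k j : ℝ) : ℝ) : ℂ) • x.1 (down j k) = 0
    rw [hM _ (by rw [down_self]; omega), smul_zero]⟩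
  map_add' x y := by
    ext k
    exact smul_add _ _ _
  map_smul' c x := by
    ext k
    exact smul_comm _ _ _

theorem summable_sys (T : H →L[ℂ] H) (x : Joint H n) :
    Summable (fun k => ‖T (x k)‖ ^ 2) ∧ ∑' k, ‖T (x k)‖ ^ 2 ≤ (‖T‖ * ‖x‖) ^ 2 := by
  have hle : ∀ k, ‖T (x k)‖ ^ 2 ≤ ‖T‖ ^ 2 * ‖x k‖ ^ 2 := by
    intro k
    rw [← mul_pow]
    gcongr
    exact T.le_opNorm _
  have hs : Summable fun k => ‖T‖ ^ 2 * ‖x k‖ ^ 2 := (summable_sq x).mul_left _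
  have hs' := Summable.of_nonneg_of_le (fun k => by positivity) hle hs
  refine ⟨hs', (hs'.tsum_le_tsum hle hs).trans ?_⟩
  rw [tsum_mul_left, mul_pow, norm_sq_eq]

/-- The operator `T ⊗ 1` of the system alone. -/
noncomputable def onSystem (n : ℕ) (T : H →L[ℂ] H) : Joint H n →L[ℂ] Joint H n :=
  LinearMap.mkContinuous
    { toFun := fun x => ⟨fun k => T (x k), memℓp_two (summable_sys T x).1⟩
      map_add' := fun x y => by
        ext k
        exact map_add T _ _
      map_smul' := fun c x => by
        ext k
        exact map_smul T _ _ } ‖T‖ (fun x => by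
      refine (sq_le_sq₀ (norm_nonneg _) (by positivity)).mp ?_
      rw [norm_sq_eq]
      exact (summable_sys T x).2)

/-- `T ⊗ 1` on the vectors with finitely many excitations in mode `j`. -/
noncomputable def onSystemRestrict (T : H →L[ℂ] H) (j : Fin n) : Module.End ℂ (finiteExc H j) :=
  (onSystem n T).toLinearMap.restrict (p := finiteExc H j) (q := finiteExc H j) (by
    rintro x ⟨M, hM⟩
    refine ⟨M, fun k hk => ?_⟩
    change T (x k) = 0
    rw [hM k hk, map_zero])

theorem annihilation_apply (j : Fin n) (x : finiteExc H j) (k : Fin n → ℕ) :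
    ((annihilation j x : finiteExc H j) : Joint H n) k =
      ((√((k j : ℝ) + 1) : ℝ) : ℂ) • (x : Joint H n) (up j k) := rfl

theorem creation_apply (j : Fin n) (x : finiteExc H j) (k : Fin n → ℕ) :
    ((creation j x : finiteExc H j) : Joint H n) k =
      ((√(k j : ℝ) : ℝ) : ℂ) • (x : Joint H n) (down j k) := rfl

theorem onSystemRestrict_apply (T : H →L[ℂ] H) (j : Fin n) (x : finiteExc H j)
    (k : Fin n → ℕ) :
    ((onSystemRestrict T j x : finiteExc H j) : Joint H n) k = T ((x : Joint H n) k) := rfl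

theorem inner_creation (j : Fin n) (x y : finiteExc H j) :
    ⟪((creation j x : finiteExc H j) : Joint H n), (y : Joint H n)⟫_ℂ =
      ⟪(x : Joint H n), ((annihilation j y : finiteExc H j) : Joint H n)⟫_ℂ := by
  rw [lp.inner_eq_tsum, lp.inner_eq_tsum]
  have hsupp : Function.support (fun k : Fin n → ℕ =>
      ⟪((creation j x : finiteExc H j) : Joint H n) k, (y : Joint H n) k⟫_ℂ) ⊆
        Set.range (up j) := by
    intro k hk
    by_contra hk'
    refine hk ?_
    simp [creation_apply, eq_zero_of_notMem_range_up j k hk']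
  rw [← (up_injective j).tsum_eq hsupp]
  refine tsum_congr fun k => ?_
  rw [creation_apply, annihilation_apply, down_up, up_self, inner_smul_left, inner_smul_right,
    Complex.conj_ofReal]
  push_cast
  rfl

variable [CompleteSpace H]

theorem inner_onSystem (T : H →L[ℂ] H) (x y : Joint H n) :
    ⟪onSystem n T x, y⟫_ℂ = ⟪x, onSystem n T.adjoint y⟫_ℂ := by
  rw [lp.inner_eq_tsum, lp.inner_eq_tsum]
  exact tsum_congr fun k => (ContinuousLinearMap.adjoint_inner_right T _ _).symm

/-- The interaction `L ⊗ b_j† + L† ⊗ b_j` of the system with bath mode `j`. -/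
noncomputable def coupling (L : H →L[ℂ] H) (j : Fin n) : Module.End ℂ (finiteExc H j) :=
  onSystemRestrict L j ∘ₗ creation j + onSystemRestrict L.adjoint j ∘ₗ annihilation j

theorem coupling_symm (L : H →L[ℂ] H) (j : Fin n) (x y : finiteExc H j) :
    ⟪((coupling L j x : finiteExc H j) : Joint H n), (y : Joint H n)⟫_ℂ =
      ⟪(x : Joint H n), ((coupling L j y : finiteExc H j) : Joint H n)⟫_ℂ := by
  have h1 : ∀ u v : finiteExc H j,
      ⟪((onSystemRestrict L j (creation j u) : finiteExc H j) : Joint H n), (v : Joint H n)⟫_ℂ =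
      ⟪(u : Joint H n),
        ((onSystemRestrict L.adjoint j (annihilation j v) : finiteExc H j) : Joint H n)⟫_ℂ := by
    intro u v
    refine (inner_onSystem L _ _).trans ?_
    refine (inner_creation j u (onSystemRestrict L.adjoint j v)).trans ?_
    congr 1
    ext k
    exact (map_smul L.adjoint _ _).symm
  have h2 : ∀ u v : finiteExc H j,
      ⟪((onSystemRestrict L.adjoint j (annihilation j u) : finiteExc H j) : Joint H n),
        (v : Joint H n)⟫_ℂ =
      ⟪(u : Joint H n), ((onSystemRestrict L j (creation j v) : finiteExc H j) : Joint H n)⟫_ℂ := by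
    intro u v
    rw [← inner_conj_symm, ← h1, inner_conj_symm]
  simp only [coupling, LinearMap.add_apply, LinearMap.comp_apply, Submodule.coe_add,
    inner_add_left, inner_add_right, h1, h2]
  rw [add_comm]

theorem coupling_bound (L : H →L[ℂ] H) (j : Fin n) (x : finiteExc H j) {M : ℕ}
    (hM : ExcLE j M (x : Joint H n)) :
    ExcLE j (M + 1) ((coupling L j x : finiteExc H j) : Joint H n) ∧
      ‖((coupling L j x : finiteExc H j) : Joint H n)‖ ≤
        2 * ‖L‖ * √((M : ℝ) + 1) * ‖(x : Joint H n)‖ := by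
  have hroot : ∀ y : Joint H n, ‖y‖ ^ 2 ≤ ((M : ℝ) + 1) * ‖(x : Joint H n)‖ ^ 2 →
      ‖y‖ ≤ √((M : ℝ) + 1) * ‖(x : Joint H n)‖ := by
    intro y hy
    refine (sq_le_sq₀ (norm_nonneg _) (by positivity)).mp ?_
    rwa [mul_pow, Real.sq_sqrt (by positivity)]
  have hc := hroot (creation j x : finiteExc H j) (by
    rw [norm_sq_eq]; exact (summable_cre j hM).2)
  have ha := hroot (annihilation j x : finiteExc H j) (by
    rw [norm_sq_eq]; exact (summable_ann j hM).2)
  have hs : ∀ (T : H →L[ℂ] H) (y : Joint H n), ‖onSystem n T y‖ ≤ ‖T‖ * ‖y‖ := by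
    intro T y
    refine (sq_le_sq₀ (norm_nonneg _) (by positivity)).mp ?_
    rw [norm_sq_eq]
    exact (summable_sys T y).2
  constructor
  · intro k hk
    change L (((√(k j : ℝ) : ℝ) : ℂ) • (x : Joint H n) (down j k)) +
      L.adjoint (((√((k j : ℝ) + 1) : ℝ) : ℂ) • (x : Joint H n) (up j k)) = 0
    rw [hM (down j k) (by rw [down_self]; omega), hM (up j k) (by rw [up_self]; omega)]
    simp
  · change ‖onSystem n L (creation j x : finiteExc H j) +
      onSystem n L.adjoint (annihilation j x : finiteExc H j)‖ ≤ _
    have hadj : ‖L.adjoint‖ = ‖L‖ := LinearIsometryEquiv.norm_map _ _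
    calc _ ≤ ‖L‖ * (√((M : ℝ) + 1) * ‖(x : Joint H n)‖) +
          ‖L‖ * (√((M : ℝ) + 1) * ‖(x : Joint H n)‖) := by
          refine (norm_add_le _ _).trans (add_le_add ((hs _ _).trans ?_) ((hs _ _).trans ?_))
          · gcongr
          · rw [hadj]
            gcongr
      _ = _ := by ring

theorem coupling_entire (L : H →L[ℂ] H) (j : Fin n) : EntireVectors (coupling L j) := by
  intro x r
  obtain ⟨M, hM⟩ := x.2
  have hexc : ∀ m : ℕ, ExcLE j (M + m) (((coupling L j ^ m) x : finiteExc H j) : Joint H n) := by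
    intro m
    induction m with
    | zero => simpa using hM
    | succ m ih =>
      rw [pow_succ', Module.End.mul_apply]
      exact (coupling_bound L j _ ih).1
  have hstep : ∀ m : ℕ, ‖(((coupling L j ^ (m + 1)) x : finiteExc H j) : Joint H n)‖ ≤
      2 * ‖L‖ * √((M : ℝ) + m + 1) *
        ‖(((coupling L j ^ m) x : finiteExc H j) : Joint H n)‖ := by
    intro m
    rw [pow_succ', Module.End.mul_apply]
    have := (coupling_bound L j _ (hexc m)).2
    push_cast at this
    exact this
  have hlim : Filter.Tendsto
      (fun m : ℕ => |r| * (2 * ‖L‖) * (√((M : ℝ) + m + 1) / ((m : ℝ) + 1)))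
      Filter.atTop (nhds 0) := by
    have h1 : Filter.Tendsto (fun m : ℕ => √((M : ℝ) + 1) * (√((m : ℝ) + 1))⁻¹)
        Filter.atTop (nhds 0) := by
      rw [← mul_zero (√((M : ℝ) + 1))]
      refine Filter.Tendsto.const_mul _ (tendsto_inv_atTop_zero.comp ?_)
      exact Real.tendsto_sqrt_atTop.comp
        (Filter.tendsto_atTop_add_const_right _ _ tendsto_natCast_atTop_atTop)
    have h2 : Filter.Tendsto (fun m : ℕ => √((M : ℝ) + m + 1) / ((m : ℝ) + 1))
        Filter.atTop (nhds 0) := by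
      refine squeeze_zero (fun m => by positivity) (fun m => ?_) h1
      rw [div_le_iff₀ (by positivity), mul_assoc]
      have hm : ((m : ℝ) + 1) = √((m : ℝ) + 1) * √((m : ℝ) + 1) :=
        (Real.mul_self_sqrt (by positivity)).symm
      have hpos : 0 < √((m : ℝ) + 1) := by positivity
      have : (√((m : ℝ) + 1))⁻¹ * ((m : ℝ) + 1) = √((m : ℝ) + 1) := by
        nth_rewrite 2 [hm]
        rw [← mul_assoc, inv_mul_cancel₀ hpos.ne', one_mul]
      rw [this, ← Real.sqrt_mul (by positivity)]
      refine Real.sqrt_le_sqrt ?_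
      have : (0 : ℝ) ≤ (M : ℝ) * m := by positivity
      nlinarith
    simpa using h2.const_mul (|r| * (2 * ‖L‖))
  have hev := hlim.eventually (gt_mem_nhds (show (0 : ℝ) < 1 / 2 by norm_num))
  refine summable_of_ratio_norm_eventually_le (r := 1 / 2) (by norm_num) ?_
  filter_upwards [hev] with m hm
  rw [norm_mul, norm_mul, norm_norm, norm_norm, norm_div, norm_div, norm_pow, norm_pow,
    Real.norm_eq_abs, Real.norm_natCast, Real.norm_natCast, Nat.factorial_succ, Nat.cast_mul]
  calc _ ≤ |r| ^ (m + 1) / (((m + 1 : ℕ) : ℝ) * (m.factorial : ℝ)) *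
        (2 * ‖L‖ * √((M : ℝ) + m + 1) *
          ‖(((coupling L j ^ m) x : finiteExc H j) : Joint H n)‖) := by
        gcongr
        exact hstep m
    _ = (|r| * (2 * ‖L‖) * (√((M : ℝ) + m + 1) / ((m : ℝ) + 1))) *
        (|r| ^ m / (m.factorial : ℝ) *
          ‖(((coupling L j ^ m) x : finiteExc H j) : Joint H n)‖) := by
        have := Nat.factorial_ne_zero m
        push_cast
        field_simp
        ring
    _ ≤ _ := by
        gcongr

/-- The interaction Hamiltonian `√γ (L ⊗ b_j† + L† ⊗ b_j)` of the system with bath mode `j`. -/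
noncomputable def interactionHamiltonian (γ : ℝ) (L : H →L[ℂ] H) (j : Fin n) :
    Module.End ℂ (finiteExc H j) :=
  ((√γ : ℝ) : ℂ) • coupling L j

theorem existsUnique_collisionUnitary (γ : ℝ) (L : H →L[ℂ] H) (δ : ℝ) (j : Fin n) :
    ∃! U : Joint H n ≃ₗᵢ[ℂ] Joint H n,
      IsUnitaryExp (((√δ : ℝ) : ℂ) • interactionHamiltonian γ L j) U := by
  have hc : ((√δ : ℝ) : ℂ) • interactionHamiltonian γ L j =
      ((√δ * √γ : ℝ) : ℂ) • coupling L j := by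
    rw [interactionHamiltonian, smul_smul, Complex.ofReal_mul]
  rw [hc]
  refine existsUnique_isUnitaryExp (dense_finiteExc j) (fun x y => ?_) (fun x r => ?_)
  · have h := coupling_symm L j x y
    simp only [LinearMap.smul_apply, Submodule.coe_smul, inner_smul_left, inner_smul_right, h,
      Complex.conj_ofReal]
  · refine (coupling_entire L j x (r * |√δ * √γ|)).congr fun m => ?_
    rw [smul_pow, LinearMap.smul_apply, Submodule.coe_smul, norm_smul, norm_pow,
      Complex.norm_real, Real.norm_eq_abs, mul_pow]
    ring

/-- The unitary `exp(-i √δ √γ (L ⊗ b_j† + L† ⊗ b_j))` of a collision of duration `δ` with bath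
mode `j`. -/
noncomputable def collisionUnitary (γ : ℝ) (L : H →L[ℂ] H) (δ : ℝ) (j : Fin n) :
    Joint H n ≃ₗᵢ[ℂ] Joint H n :=
  (existsUnique_collisionUnitary γ L δ j).choose

theorem collisionUnitary_spec (γ : ℝ) (L : H →L[ℂ] H) (δ : ℝ) (j : Fin n) :
    IsUnitaryExp (((√δ : ℝ) : ℂ) • interactionHamiltonian γ L j) (collisionUnitary γ L δ j) :=
  (existsUnique_collisionUnitary γ L δ j).choose_spec.1

/-- The joint evolution `exp(-i δ H_c(t_j)) exp(-i √δ H_j)` over one time bin of length `δ`. The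
bins are numbered by `j = 0, …, n - 1`, and bin `j` ends at the time `(j + 1) δ`, at which the
control Hamiltonian is sampled. -/
noncomputable def binEvolution (Hc : ℝ → H →L[ℂ] H) (γ : ℝ) (L : H →L[ℂ] H) (δ : ℝ)
    (j : Fin n) : Joint H n →L[ℂ] Joint H n :=
  NormedSpace.exp ((-(Complex.I * (δ : ℂ))) • onSystem n (Hc (((j : ℕ) + 1 : ℝ) * δ))) ∘L
    (collisionUnitary γ L δ j : Joint H n →L[ℂ] Joint H n)

/-- The joint evolution over the first `i` of the `n` time bins, later bins acting on the left. -/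
noncomputable def jointEvolution (n : ℕ) (Hc : ℝ → H →L[ℂ] H) (γ : ℝ) (L : H →L[ℂ] H) (δ : ℝ) :
    ℕ → Joint H n →L[ℂ] Joint H n
  | 0 => ContinuousLinearMap.id ℂ (Joint H n)
  | i + 1 =>
    if h : i < n then binEvolution Hc γ L δ ⟨i, h⟩ ∘L jointEvolution n Hc γ L δ i
    else jointEvolution n Hc γ L δ i

/-- The state vector `U_n ⋯ U_1 (ψ ⊗ |0, …, 0⟩)` at time `t` of the collisional purification with
`n` time bins of length `t / n`. -/
noncomputable def purification (Hc : ℝ → H →L[ℂ] H) (γ : ℝ) (L : H →L[ℂ] H) (ψ : H) (t : ℝ)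
    (n : ℕ) : Joint H n :=
  jointEvolution n Hc γ L (t / n) n (lp.single 2 0 ψ)

/-- The Lindblad generator `-i [H, ρ] + γ (L ρ L† - {L† L, ρ} / 2)`. -/
noncomputable def lindbladian (Hc : H →L[ℂ] H) (γ : ℝ) (L : H →L[ℂ] H) (ρ : H →L[ℂ] H) :
    H →L[ℂ] H :=
  (-Complex.I) • (Hc * ρ - ρ * Hc) +
    (γ : ℂ) • (L * ρ * L.adjoint -
      (1 / 2 : ℂ) • (L.adjoint * L * ρ + ρ * (L.adjoint * L)))

/-- `ρ` solves the Lindblad master equation for times `t ≥ 0`, from the pure state `|ψ⟩⟨ψ|`. -/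
def IsLindbladSolution (Hc : ℝ → H →L[ℂ] H) (γ : ℝ) (L : H →L[ℂ] H) (ψ : H)
    (ρ : ℝ → H →L[ℂ] H) : Prop :=
  ρ 0 = InnerProductSpace.rankOne ℂ ψ ψ ∧
    ∀ t : ℝ, 0 ≤ t → HasDerivWithinAt ρ (lindbladian (Hc t) γ L (ρ t)) (Set.Ici 0) t

end Chain

/-- The family of unit vectors `Ψ` is differentiable at `θ`, and its quantum Fisher information there
is `F = 4 (⟨∂Ψ|∂Ψ⟩ - |⟨Ψ|∂Ψ⟩|²)`. -/
def HasPureQFI {E : Type*} [NormedAddCommGroup E] [InnerProductSpace ℂ E]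
    (Ψ : ℝ → E) (θ : ℝ) (F : ℝ) : Prop :=
  ∃ Ψ' : E, HasDerivAt Ψ Ψ' θ ∧ F = 4 * (‖Ψ'‖ ^ 2 - ‖⟪Ψ θ, Ψ'⟫_ℂ‖ ^ 2)

/-- The trace of an operator (which has to be of trace class), as the sum of its diagonal matrix
elements in the orthonormal basis `e`. -/
noncomputable def traceIn {H ι : Type*} [NormedAddCommGroup H] [InnerProductSpace ℂ H]
    (e : HilbertBasis ι ℂ H) (T : H →L[ℂ] H) : ℂ :=
  ∑' i, ⟪e i, T (e i)⟫_ℂ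

end Collisional

/-! With finitely many collisions the QFI is exactly a Riemann sum. The parameter enters collision j
only through √γ in exp(-i√δ√γ G), where G = L⊗b_j† + L†⊗b_j, so differentiating the state adds,
inside the unitaries, the vector -i√δ (∂√γ) GΦ. When mode j collides it is still in the vacuum, both
in the state Φ and in the derivative accumulated so far, whereas GΦ has exactly one excitation in
it. The new contribution is orthogonal to both: the overlap of the state with its derivative stays
zero, and the squared norms add by Pythagoras, with ‖GΦ‖ = ‖(L⊗1)Φ‖. Hence the QFI equals 4(∂√γ)² δ
Σ ‖(L⊗1)Φ_l‖², where Φ_l is the state after l bins (`exists_hasDerivAt_jointEvolution`,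
`hasPureQFI_purification`).

For the limit, the states are viewed as functionals X ↦ ⟨Φ_l, (X⊗1)Φ_l⟩ on the bounded operators.
The same vacuum property kills the terms of order √δ, so one bin is an Euler step of the dual
Lindblad equation up to δ^(3/2), uniformly in n (`exists_local_error`). The Riemann sum is exactly
the Euler scheme of q' = f(L†L). Convergence of Euler schemes for the pair (f, q) gives the limit of
the QFI and its time derivative together (`euler_tendsto`, `exists_limit_flow`).

It remains to recognise f(L†L) as a trace. In infinite dimension a bounded functional need not come
from a density operator, but f(t) is a norm limit of vector functionals, hence normal
(`IsNormalIn.of_tendsto`), and its matrix elements are those of ρ(t) by uniqueness for the Lindblad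
equation (`apply_rankOne_eq_inner`). Expanding L†L along the basis projections gives the convergent
trace. The linear bound holds already for the Riemann sums, since every Φ_l is a unit vector. -/

open scoped InnerProductSpace

namespace Collisional

/-! ### Linear differential equations in a Banach space: Picard series and Euler schemes. -/

section LinearODE

variable {E : Type*} [NormedAddCommGroup E] [NormedSpace ℝ E]

/-- The Picard iterates of the linear equation `u' = A u`, `u 0 = x₀`. -/
noncomputable def picardTerm (A : ℝ → E →L[ℝ] E) (x₀ : E) : ℕ → ℝ → E
  | 0 => fun _ => x₀
  | k + 1 => fun t => ∫ s in (0 : ℝ)..t, A s (picardTerm A x₀ k s)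

theorem continuous_picardTerm [CompleteSpace E] {A : ℝ → E →L[ℝ] E} (hA : Continuous A) (x₀ : E)
    (k : ℕ) : Continuous (picardTerm A x₀ k) := by
  induction k with
  | zero => exact continuous_const
  | succ k ih =>
    exact intervalIntegral.continuous_primitive (fun a b => (hA.clm_apply ih).intervalIntegrable a b) 0

theorem hasDerivAt_picardTerm_succ [CompleteSpace E] {A : ℝ → E →L[ℝ] E} (hA : Continuous A)
    (x₀ : E) (k : ℕ) (t : ℝ) :
    HasDerivAt (picardTerm A x₀ (k + 1)) (A t (picardTerm A x₀ k t)) t := by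
  have hc := hA.clm_apply (continuous_picardTerm hA x₀ k)
  exact intervalIntegral.integral_hasDerivAt_right (hc.intervalIntegrable _ _)
    hc.stronglyMeasurable.stronglyMeasurableAtFilter hc.continuousAt

/-- Each iterated integration raises the power of s by one, and these integrations produce the
factorial that makes the series converge uniformly on bounded intervals. -/
theorem norm_picardTerm_le {A : ℝ → E →L[ℝ] E} (x₀ : E) {M R : ℝ}
    (hM : ∀ s, |s| ≤ R → ‖A s‖ ≤ M) (k : ℕ) :
    ∀ t, |t| ≤ R → ‖picardTerm A x₀ k t‖ ≤ (M * |t|) ^ k / (k.factorial : ℝ) * ‖x₀‖ := by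
  induction k with
  | zero => intro t _; simp [picardTerm]
  | succ k ih =>
    intro t ht
    have hM0 : 0 ≤ M := (norm_nonneg _).trans (hM t ht)
    have hint : ∀ b : ℝ, ∫ s in (0 : ℝ)..b, M * ((M * s) ^ k / (k.factorial : ℝ) * ‖x₀‖) =
        (M * b) ^ (k + 1) / ((k + 1).factorial : ℝ) * ‖x₀‖ := by
      intro b
      have : ∀ s : ℝ, M * ((M * s) ^ k / (k.factorial : ℝ) * ‖x₀‖) =
          (M ^ (k + 1) / (k.factorial : ℝ) * ‖x₀‖) * s ^ k := by
        intro s; rw [mul_pow]; ring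
      simp_rw [this]
      rw [intervalIntegral.integral_const_mul, integral_pow, Nat.factorial_succ]
      have := Nat.factorial_ne_zero k
      push_cast
      rw [mul_pow]
      field_simp
      simp
    have hbound : ∀ s, |s| ≤ R →
        ‖A s (picardTerm A x₀ k s)‖ ≤ M * ((M * |s|) ^ k / (k.factorial : ℝ) * ‖x₀‖) := by
      intro s hs
      refine ((A s).le_opNorm _).trans ?_
      gcongr
      · exact hM s hs
      · exact ih s hs
    change ‖∫ s in (0 : ℝ)..t, A s (picardTerm A x₀ k s)‖ ≤ _
    rcases le_total 0 t with h0 | h0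
    · rw [abs_of_nonneg h0] at ht ⊢
      rw [← hint]
      refine intervalIntegral.norm_integral_le_of_norm_le h0 ?_
        (Continuous.intervalIntegrable (by fun_prop) _ _)
      filter_upwards with s hs
      have := hbound s (by rw [abs_of_nonneg hs.1.le]; exact hs.2.trans ht)
      rwa [abs_of_nonneg hs.1.le] at this
    -- Negative times reduce to positive ones by the reflection s ↦ -s.
    · rw [abs_of_nonpos h0] at ht ⊢
      have hneg := intervalIntegral.integral_comp_neg (a := 0) (b := -t)
        (fun s => A s (picardTerm A x₀ k s))
      rw [neg_neg, neg_zero] at hneg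
      rw [← hint, intervalIntegral.integral_symm, norm_neg, ← hneg]
      refine intervalIntegral.norm_integral_le_of_norm_le (by linarith) ?_
        (Continuous.intervalIntegrable (by fun_prop) _ _)
      filter_upwards with s hs
      have := hbound (-s) (by rw [abs_neg, abs_of_nonneg hs.1.le]; exact hs.2.trans ht)
      rwa [abs_neg, abs_of_nonneg hs.1.le] at this

/-- A linear equation with norm-continuous coefficients has a global solution. -/
theorem exists_linear_ode_solution [CompleteSpace E] {A : ℝ → E →L[ℝ] E} (hA : Continuous A)
    (x₀ : E) : ∃ u : ℝ → E, u 0 = x₀ ∧ ∀ t, HasDerivAt u (A t (u t)) t := by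
  refine ⟨fun t => ∑' k, picardTerm A x₀ k t, ?_, fun t => ?_⟩
  · change ∑' k, picardTerm A x₀ k 0 = x₀
    rw [tsum_eq_single 0]
    · rfl
    · rintro (_ | k) hk
      · exact absurd rfl hk
      · simp [picardTerm]
  · obtain ⟨M, hM⟩ : ∃ M, ∀ s, |s| ≤ |t| + 1 → ‖A s‖ ≤ M := by
      obtain ⟨M, hM⟩ := (isCompact_Icc (a := -(|t| + 1)) (b := |t| + 1)).exists_bound_of_continuousOn
        hA.continuousOn
      exact ⟨M, fun s hs => hM s (abs_le.mp hs)⟩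
    have hM0 : 0 ≤ M := (norm_nonneg _).trans (hM t (by linarith))
    have hterm : ∀ s, |s| ≤ |t| + 1 → ∀ k, ‖picardTerm A x₀ k s‖ ≤
        (M * (|t| + 1)) ^ k / (k.factorial : ℝ) * ‖x₀‖ := by
      intro s hs k
      refine (norm_picardTerm_le x₀ hM k s hs).trans ?_
      gcongr
    have hu : Summable fun k : ℕ => (M * (|t| + 1)) ^ k / (k.factorial : ℝ) * ‖x₀‖ :=
      (Real.summable_pow_div_factorial _).mul_right _
    have hsum : ∀ s, |s| ≤ |t| + 1 → Summable fun k => picardTerm A x₀ k s := fun s hs =>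
      Summable.of_norm_bounded hu (hterm s hs)
    -- The constant term is split off: the derivative of term k + 1 is A applied to term k, so the
    -- differentiated series is A applied to the full one. The radius |t| + 1 gives an open interval
    -- containing both t and 0.
    have key : HasDerivAt (fun s => ∑' k, picardTerm A x₀ (k + 1) s)
        (∑' k, A t (picardTerm A x₀ k t)) t := by
      refine hasDerivAt_tsum_of_isPreconnected (u := fun k : ℕ =>
        M * ((M * (|t| + 1)) ^ k / (k.factorial : ℝ) * ‖x₀‖))
        (g := fun k => picardTerm A x₀ (k + 1)) (g' := fun k s => A s (picardTerm A x₀ k s))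
        (t := Set.Ioo (-(|t| + 1)) (|t| + 1)) (y₀ := 0)
        (hu.mul_left M) isOpen_Ioo isPreconnected_Ioo
        (fun k s _ => hasDerivAt_picardTerm_succ hA x₀ k s) ?_ ?_ ?_ ?_
      · intro k s hs
        have hs' : |s| ≤ |t| + 1 := (abs_lt.mpr hs).le
        refine ((A s).le_opNorm _).trans ?_
        gcongr
        · exact hM s hs'
        · exact hterm s hs' k
      · constructor <;> [skip; skip] <;> have := abs_nonneg t <;> linarith
      · exact (summable_nat_add_iff 1).mpr (hsum 0 (by simp; positivity))
      · exact abs_lt.mp (by linarith)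
    rw [← (A t).map_tsum (hsum t (by linarith))] at key
    refine (key.const_add x₀).congr_of_eventuallyEq ?_
    filter_upwards [Ioo_mem_nhds (show -(|t| + 1) < t by have := neg_abs_le t; linarith)
      (show t < |t| + 1 by have := le_abs_self t; linarith)] with s hs
    rw [(hsum s (abs_lt.mpr hs).le).tsum_eq_zero_add]
    rfl

/-- Convergence of a perturbed Euler scheme for a linear equation, with coefficients sampled at the
end of each step. -/
theorem euler_tendsto {A : ℝ → E →L[ℝ] E} (hA : Continuous A) {u : ℝ → E}
    (hu : ∀ t, HasDerivAt u (A t (u t)) t) {T : ℝ} (hT : 0 ≤ T) (g : ℕ → ℕ → E)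
    (hg0 : ∀ n, g n 0 = u 0) {η : ℕ → ℝ} (hη : Filter.Tendsto η Filter.atTop (nhds 0))
    (hg : ∀ n i, i < n → ‖g n (i + 1) - g n i - (T / n) • A ((i + 1) * (T / n)) (g n i)‖ ≤
      T / n * η n) :
    Filter.Tendsto (fun n => g n n) Filter.atTop (nhds (u T)) := by
  obtain ⟨M, hM⟩ : ∃ M, ∀ s ∈ Set.Icc 0 T, ‖A s‖ ≤ M :=
    isCompact_Icc.exists_bound_of_continuousOn hA.continuousOn
  have hM0 : 0 ≤ M := (norm_nonneg _).trans (hM 0 ⟨le_rfl, hT⟩)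
  have huc : Continuous u := continuous_iff_continuousAt.mpr fun t => (hu t).continuousAt
  have hB : Continuous fun p : ℝ × ℝ => A p.1 (u p.2) := by fun_prop
  -- Two time variables are needed because a step evaluates the coefficient at its end and the
  -- solution at its beginning.
  have hunif : UniformContinuousOn (fun p : ℝ × ℝ => A p.1 (u p.2))
      (Set.Icc 0 T ×ˢ Set.Icc 0 T) :=
    (isCompact_Icc.prod isCompact_Icc).uniformContinuousOn_of_continuous hB.continuousOn
  rw [tendsto_iff_norm_sub_tendsto_zero]
  rw [Metric.tendsto_atTop]
  intro ε hε
  -- T exp(MT) is the total amplification of the step errors; the summand 1 keeps K positive when T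
  -- = 0.
  set K : ℝ := T * Real.exp (M * T) + 1 with hK
  have hK0 : 0 < K := by positivity
  obtain ⟨d, hd, hd'⟩ := Metric.uniformContinuousOn_iff.mp hunif (ε / (4 * K)) (by positivity)
  obtain ⟨N₁, hN₁⟩ := Metric.tendsto_atTop.mp hη (ε / (4 * K)) (by positivity)
  obtain ⟨N₂, hN₂⟩ := Metric.tendsto_atTop.mp (tendsto_const_div_atTop_nhds_zero_nat T) d hd
  refine ⟨max 1 (max N₁ N₂), fun n hn => ?_⟩
  have hn1 : 0 < n := by omega
  have hn0 : (0 : ℝ) < n := by exact_mod_cast hn1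
  set δ : ℝ := T / n with hδ
  have hδ0 : 0 ≤ δ := by positivity
  have hnδ : n * δ = T := by rw [hδ]; field_simp
  have hηn : η n ≤ ε / (4 * K) := by
    have := hN₁ n (by omega)
    rw [Real.dist_eq, sub_zero] at this
    exact (le_abs_self _).trans this.le
  have hδd : δ < d := by
    have := hN₂ n (by omega)
    rw [Real.dist_eq, sub_zero] at this
    exact (le_abs_self _).trans_lt this
  have hmem : ∀ i : ℕ, i ≤ n → (i : ℝ) * δ ∈ Set.Icc 0 T := by
    intro i hi
    refine ⟨by positivity, ?_⟩
    rw [← hnδ]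
    gcongr
  have hloc : ∀ i : ℕ, i < n → ‖u ((i + 1 : ℝ) * δ) - u (i * δ) -
      δ • A ((i + 1 : ℝ) * δ) (u (i * δ))‖ ≤ δ * (ε / (4 * K)) := by
    intro i hi
    have hi1 := hmem (i + 1) hi
    push_cast at hi1
    have hi0 := hmem i hi.le
    set a := (i : ℝ) * δ
    set b := ((i : ℝ) + 1) * δ with hb
    have hab : b = a + δ := by simp only [hb, a]; ring
    have hmv : ‖(u b - b • A b (u a)) - (u a - a • A b (u a))‖ ≤ (ε / (4 * K)) * ‖b - a‖ := by
      refine (convex_Icc a b).norm_image_sub_le_of_norm_hasDerivWithin_le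
        (f := fun s => u s - s • A b (u a)) (f' := fun s => A s (u s) - A b (u a)) ?_ ?_
        (Set.left_mem_Icc.mpr (by linarith)) (Set.right_mem_Icc.mpr (by linarith))
      · intro s hs
        have := (hu s).sub ((hasDerivAt_id s).smul_const (A b (u a)))
        rw [one_smul] at this
        exact this.hasDerivWithinAt
      · intro s hs
        have hs' : s ∈ Set.Icc 0 T := ⟨hi0.1.trans hs.1, hs.2.trans hi1.2⟩
        have := hd' (s, s) ⟨hs', hs'⟩ (b, a) ⟨hi1, hi0⟩ ?_
        · rw [dist_eq_norm] at this
          exact this.le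
        · rw [Prod.dist_eq, Real.dist_eq, Real.dist_eq, max_lt_iff, abs_lt, abs_lt]
          refine ⟨⟨?_, ?_⟩, ?_, ?_⟩ <;> linarith [hs.1, hs.2]
    rw [show b - a = δ by linarith, Real.norm_of_nonneg hδ0, mul_comm] at hmv
    refine le_trans (le_of_eq ?_) hmv
    rw [show δ = b - a by linarith, sub_smul]
    congr 1
    abel
  -- Discrete Grönwall: consistency error and perturbation contribute ε/(4K) each per unit time, and
  -- every step amplifies the old error by at most 1 + Mδ ≤ exp(Mδ).
  have herr : ∀ i : ℕ, i ≤ n → ‖g n i - u (i * δ)‖ ≤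
      i * (δ * (ε / (2 * K))) * Real.exp (M * (i * δ)) := by
    intro i
    induction i with
    | zero => intro _; simp [hg0]
    | succ i ih =>
      intro hi
      have hi' : i < n := hi
      have h1 := hg n i hi'
      have h2 := hloc i hi'
      have h3 := ih hi'.le
      have hi1 := hM _ (hmem (i + 1) hi)
      push_cast at hi1 ⊢
      set a := (i : ℝ) * δ
      set b := ((i : ℝ) + 1) * δ with hb
      have hab : b = a + δ := by simp only [hb, a]; ring
      have hdec : g n (i + 1) - u b = (g n (i + 1) - g n i - δ • A b (g n i)) -
          (u b - u a - δ • A b (u a)) + ((g n i - u a) + δ • A b (g n i - u a)) := by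
        rw [map_sub, smul_sub]; abel
      rw [hdec]
      have hcoef : 1 + M * δ ≤ Real.exp (M * δ) := by
        have := Real.add_one_le_exp (M * δ); linarith
      have h4 : ‖(g n i - u a) + δ • A b (g n i - u a)‖ ≤ Real.exp (M * δ) * ‖g n i - u a‖ := by
        refine (norm_add_le _ _).trans ?_
        rw [norm_smul, Real.norm_of_nonneg hδ0]
        have : ‖A b (g n i - u a)‖ ≤ M * ‖g n i - u a‖ :=
          ((A b).le_opNorm _).trans (by gcongr)
        nlinarith [norm_nonneg (g n i - u a), mul_le_mul_of_nonneg_left this hδ0]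
      have h5 : Real.exp (M * b) = Real.exp (M * δ) * Real.exp (M * a) := by
        rw [hab, ← Real.exp_add]; ring_nf
      have h6 : (1 : ℝ) ≤ Real.exp (M * δ) * Real.exp (M * a) := by
        rw [← h5]; refine Real.one_le_exp ?_
        rw [hab]; positivity
      have h7 : δ * η n ≤ δ * (ε / (4 * K)) := by gcongr
      have h8 : δ * (ε / (4 * K)) + δ * (ε / (4 * K)) = δ * (ε / (2 * K)) := by
        field_simp; ring
      have h9 : 0 ≤ δ * (ε / (2 * K)) := by positivity
      rw [h5]
      calc _ ≤ δ * (ε / (2 * K)) + Real.exp (M * δ) *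
            (i * (δ * (ε / (2 * K))) * Real.exp (M * a)) := by
            refine (norm_add_le _ _).trans (add_le_add ((norm_sub_le _ _).trans ?_) (h4.trans ?_))
            · linarith
            · gcongr
        _ ≤ _ := by nlinarith
  have hfin := herr n le_rfl
  rw [hnδ] at hfin
  rw [dist_zero_right, norm_norm]
  refine hfin.trans_lt ?_
  have : (n : ℝ) * (δ * (ε / (2 * K))) * Real.exp (M * T) =
      (T * Real.exp (M * T)) / K * (ε / 2) := by
    rw [← mul_assoc, hnδ]; field_simp
  rw [this]
  have h1 : T * Real.exp (M * T) / K ≤ 1 := by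
    rw [div_le_one hK0]; linarith
  have h2 : 0 ≤ T * Real.exp (M * T) / K := by positivity
  nlinarith

end LinearODE

/-! ### Taylor estimates for the collision and control exponentials. -/

section Taylor

theorem expSeries_zero {E : Type*} [NormedAddCommGroup E] [InnerProductSpace ℂ E]
    {D : Submodule ℂ E} {A : Module.End ℂ D} (x : D) : expSeries A 0 x = (x : E) := by
  rw [expSeries, tsum_eq_single 0]
  · simp
  · intro m hm
    simp [hm]

variable {E : Type*} [NormedAddCommGroup E] [InnerProductSpace ℂ E] [CompleteSpace E]
variable {D : Submodule ℂ E} {A : Module.End ℂ D}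

/-- Although A may be unbounded, A x is again an entire vector, and its series dominates the
termwise derivatives on every disc. -/
theorem hasDerivAt_expSeries (hA : EntireVectors A) (z : ℂ) (x : D) :
    HasDerivAt (fun w => expSeries A w x) (expSeries A z (A x)) z := by
  have hs := fun w => (hasSum_expSeries hA w x).summable
  have key : HasDerivAt
      (fun w => ∑' m : ℕ, (w ^ (m + 1) / ((m + 1).factorial : ℂ)) • ((A ^ (m + 1)) x : E))
      (∑' m : ℕ, (z ^ m / (m.factorial : ℂ)) • ((A ^ m) (A x) : E)) z := by
    refine hasDerivAt_tsum_of_isPreconnected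
      (u := fun m : ℕ => (‖z‖ + 1) ^ m / (m.factorial : ℝ) * ‖((A ^ m) (A x) : E)‖)
      (g := fun m w => (w ^ (m + 1) / ((m + 1).factorial : ℂ)) • ((A ^ (m + 1)) x : E))
      (g' := fun m w => (w ^ m / (m.factorial : ℂ)) • ((A ^ m) (A x) : E))
      (t := Metric.ball 0 (‖z‖ + 1)) (y₀ := 0) (hA (A x) _) Metric.isOpen_ball
      (convex_ball (0 : ℂ) (‖z‖ + 1)).isPreconnected ?_ ?_ ?_ ?_ ?_
    · intro m w _
      have h := ((hasDerivAt_pow (m + 1) w).div_const ((m + 1).factorial : ℂ)).smul_const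
        ((A ^ (m + 1)) x : E)
      convert h using 1
      rw [pow_succ, Module.End.mul_apply, Nat.factorial_succ]
      congr 1
      have := Nat.factorial_ne_zero m
      push_cast
      field_simp
    · intro m w hw
      rw [norm_smul, norm_div, norm_pow, Complex.norm_natCast]
      have : ‖w‖ ≤ ‖z‖ + 1 := (mem_ball_zero_iff.mp hw).le
      gcongr
    · exact Metric.mem_ball_self (by positivity)
    · exact (summable_nat_add_iff (f := fun m : ℕ =>
        ((0 : ℂ) ^ m / (m.factorial : ℂ)) • ((A ^ m) x : E)) 1).mpr (hs 0)
    · rw [mem_ball_zero_iff]; linarith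
  refine (key.const_add (x : E)).congr_of_eventuallyEq (Filter.Eventually.of_forall fun w => ?_)
  change expSeries A w x = _
  rw [expSeries, (hs w).tsum_eq_zero_add]
  simp

/-- Taylor's inequality for a one-parameter family of isometries `exp(-i a A)`. -/
theorem norm_expSeries_sub_taylor_le (hA : EntireVectors A)
    (hiso : ∀ a : ℝ, 0 ≤ a → ∀ x : D, ‖expSeries A (-Complex.I * a) x‖ = ‖(x : E)‖) (N : ℕ) :
    ∀ (x : D) (a : ℝ), 0 ≤ a → ‖expSeries A (-Complex.I * a) x -
      ∑ m ∈ Finset.range N, ((-Complex.I * a) ^ m / (m.factorial : ℂ)) • ((A ^ m) x : E)‖ ≤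
        a ^ N * ‖((A ^ N) x : E)‖ := by
  induction N with
  | zero => intro x a ha; simpa using (hiso a ha x).le
  | succ N ih =>
    intro x a ha
    set f : ℝ → E := fun s => expSeries A (-Complex.I * s) x -
      ∑ m ∈ Finset.range (N + 1), ((-Complex.I * s) ^ m / (m.factorial : ℂ)) • ((A ^ m) x : E)
      with hf
    have hlin : ∀ s : ℝ, HasDerivAt (fun r : ℝ => -Complex.I * (r : ℂ)) (-Complex.I) s := by
      intro s
      simpa using (Complex.ofRealCLM.hasDerivAt (x := s)).const_mul (-Complex.I)
    -- The derivative of the remainder of order N + 1 at x is -i times the remainder of order N at A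
    -- x, so the induction must run over all x.
    have hderiv : ∀ s : ℝ, HasDerivAt f ((-Complex.I) • (expSeries A (-Complex.I * s) (A x) -
        ∑ m ∈ Finset.range N,
          ((-Complex.I * s) ^ m / (m.factorial : ℂ)) • ((A ^ m) (A x) : E))) s := by
      intro s
      have h1 := (hasDerivAt_expSeries hA (-Complex.I * s) x).scomp s (hlin s)
      have h2 : HasDerivAt (fun r : ℝ => ∑ m ∈ Finset.range N,
          ((-Complex.I * r) ^ (m + 1) / ((m + 1).factorial : ℂ)) • ((A ^ (m + 1)) x : E))
          (∑ m ∈ Finset.range N, (-Complex.I) •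
            ((-Complex.I * s) ^ m / (m.factorial : ℂ)) • ((A ^ m) (A x) : E)) s := by
        refine HasDerivAt.fun_sum fun m _ => ?_
        have h := ((((hasDerivAt_pow (m + 1) (-Complex.I * (s : ℂ))).comp s (hlin s)).div_const
          ((m + 1).factorial : ℂ)).smul_const ((A ^ (m + 1)) x : E))
        refine h.congr_deriv ?_
        rw [smul_smul, pow_succ A, Module.End.mul_apply, Nat.factorial_succ]
        congr 1
        have := Nat.factorial_ne_zero m
        push_cast
        field_simp
      have h3 := h1.sub (h2.add_const (x : E))
      rw [← Finset.smul_sum, ← smul_sub] at h3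
      refine h3.congr_of_eventuallyEq (Filter.Eventually.of_forall fun r => ?_)
      simp only [hf, Pi.sub_apply, Function.comp_apply, Finset.sum_range_succ']
      simp
    have hmv := (convex_Icc 0 a).norm_image_sub_le_of_norm_hasDerivWithin_le
      (f := f) (C := a ^ N * ‖((A ^ (N + 1)) x : E)‖) (fun s _ => (hderiv s).hasDerivWithinAt) ?_
      (Set.left_mem_Icc.mpr ha) (Set.right_mem_Icc.mpr ha)
    · have h0 : f 0 = 0 := by
        simp [hf, Finset.sum_range_succ', expSeries_zero]
      rw [h0, sub_zero, sub_zero, Real.norm_of_nonneg ha] at hmv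
      refine hmv.trans (le_of_eq ?_)
      ring
    · intro s hs
      rw [norm_smul, norm_neg, Complex.norm_I, one_mul]
      refine (ih (A x) s hs.1).trans ?_
      rw [pow_succ A, Module.End.mul_apply]
      have := hs.1
      have := hs.2
      gcongr

variable {B : E →L[ℂ] E}

theorem exp_mem_unitary (hB : IsSelfAdjoint B) (a : ℝ) :
    NormedSpace.exp ((-(Complex.I * (a : ℂ))) • B) ∈ unitary (E →L[ℂ] E) := by
  let +nondep : NormedAlgebra ℚ (E →L[ℂ] E) := .restrictScalars ℚ ℂ _
  refine NormedSpace.exp_mem_unitary_of_mem_skewAdjoint ?_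
  rw [skewAdjoint.mem_iff, star_smul, hB.star_eq, ← neg_smul]
  congr 1
  simp

theorem inner_exp_apply (hB : IsSelfAdjoint B) (a : ℝ) (x y : E) :
    ⟪NormedSpace.exp ((-(Complex.I * (a : ℂ))) • B) x,
      NormedSpace.exp ((-(Complex.I * (a : ℂ))) • B) y⟫_ℂ = ⟪x, y⟫_ℂ := by
  have h := (Unitary.mem_iff.mp (exp_mem_unitary hB a)).1
  rw [← ContinuousLinearMap.adjoint_inner_right, ← mul_apply_eq_comp,
    ← ContinuousLinearMap.star_eq_adjoint, h]
  rfl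

theorem norm_exp_apply (hB : IsSelfAdjoint B) (a : ℝ) (x : E) :
    ‖NormedSpace.exp ((-(Complex.I * (a : ℂ))) • B) x‖ = ‖x‖ := by
  rw [@norm_eq_sqrt_re_inner ℂ, @norm_eq_sqrt_re_inner ℂ, inner_exp_apply hB]

theorem hasDerivAt_exp_apply (B : E →L[ℂ] E) (y : E) (a : ℝ) :
    HasDerivAt (fun s : ℝ => NormedSpace.exp ((-(Complex.I * (s : ℂ))) • B) y)
      (-(Complex.I • B (NormedSpace.exp ((-(Complex.I * (a : ℂ))) • B) y))) a := by
  have h := (hasDerivAt_exp_smul_const' (𝕂 := ℂ) B (-(Complex.I * (a : ℂ)))).clm_apply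
    (hasDerivAt_const _ y)
  have hlin : HasDerivAt (fun r : ℝ => -(Complex.I * (r : ℂ))) (-Complex.I) a := by
    simpa using ((Complex.ofRealCLM.hasDerivAt (x := a)).const_mul Complex.I).fun_neg
  refine (h.scomp a hlin).congr_deriv ?_
  rw [map_zero, add_zero, neg_smul]
  rfl

theorem norm_exp_apply_sub_le (hB : IsSelfAdjoint B) (y : E) {a : ℝ} (ha : 0 ≤ a) :
    ‖NormedSpace.exp ((-(Complex.I * (a : ℂ))) • B) y - y‖ ≤ a * (‖B‖ * ‖y‖) := by
  have hmv := (convex_Icc 0 a).norm_image_sub_le_of_norm_hasDerivWithin_le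
    (f := fun s : ℝ => NormedSpace.exp ((-(Complex.I * (s : ℂ))) • B) y) (C := ‖B‖ * ‖y‖)
    (fun s _ => (hasDerivAt_exp_apply B y s).hasDerivWithinAt) (fun s _ => ?_)
    (Set.left_mem_Icc.mpr ha) (Set.right_mem_Icc.mpr ha)
  · simpa [abs_of_nonneg ha, mul_comm] using hmv
  · rw [norm_neg, norm_smul, Complex.norm_I, one_mul]
    refine (B.le_opNorm _).trans ?_
    rw [norm_exp_apply hB]

theorem norm_exp_apply_sub_sub_le (hB : IsSelfAdjoint B) (y : E) {a : ℝ} (ha : 0 ≤ a) :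
    ‖NormedSpace.exp ((-(Complex.I * (a : ℂ))) • B) y - y + (a : ℂ) • Complex.I • B y‖ ≤
      a ^ 2 * (‖B‖ ^ 2 * ‖y‖) := by
  have hmv := (convex_Icc 0 a).norm_image_sub_le_of_norm_hasDerivWithin_le
    (f := fun s : ℝ => NormedSpace.exp ((-(Complex.I * (s : ℂ))) • B) y + (s : ℂ) • Complex.I • B y)
    (f' := fun s : ℝ => -(Complex.I • B (NormedSpace.exp ((-(Complex.I * (s : ℂ))) • B) y)) +
      (1 : ℂ) • Complex.I • B y)
    (C := a * (‖B‖ ^ 2 * ‖y‖))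
    (fun s _ => ((hasDerivAt_exp_apply B y s).add
      ((Complex.ofRealCLM.hasDerivAt (x := s)).smul_const _)).hasDerivWithinAt) (fun s hs => ?_)
    (Set.left_mem_Icc.mpr ha) (Set.right_mem_Icc.mpr ha)
  · simp only [Complex.ofReal_zero, mul_zero, neg_zero, zero_smul, NormedSpace.exp_zero, add_zero,
      sub_zero, Real.norm_of_nonneg ha] at hmv
    rw [sub_add_eq_add_sub]
    refine hmv.trans (le_of_eq ?_)
    ring
  · rw [one_smul, neg_add_eq_sub, ← smul_sub, ← map_sub, norm_smul, Complex.norm_I, one_mul]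
    refine (B.le_opNorm _).trans ?_
    rw [norm_sub_rev]
    calc _ ≤ ‖B‖ * (s * (‖B‖ * ‖y‖)) := by gcongr; exact norm_exp_apply_sub_le hB y hs.1
      _ ≤ ‖B‖ * (a * (‖B‖ * ‖y‖)) := by gcongr; exact hs.2
      _ = _ := by ring

end Taylor

/-! ### The coupling on vectors whose colliding mode is empty. -/

section Vacuum

theorem isClosed_setOf_coord_eq_zero {H : Type*} [NormedAddCommGroup H] {n : ℕ} (k : Fin n → ℕ) :
    IsClosed {x : Joint H n | x k = 0} := by
  have hcont : Continuous fun x : Joint H n => x k := by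
    refine (LipschitzWith.of_dist_le_mul (K := 1) fun x y => ?_).continuous
    rw [dist_eq_norm, dist_eq_norm, NNReal.coe_one, one_mul]
    exact lp.norm_apply_le_norm (by norm_num) (x - y) k
  exact isClosed_eq hcont continuous_const

variable {H : Type*} [NormedAddCommGroup H] [InnerProductSpace ℂ H] {n : ℕ}

theorem onSystem_apply (T : H →L[ℂ] H) (x : Joint H n) (k : Fin n → ℕ) :
    onSystem n T x k = T (x k) := rfl

theorem norm_onSystem_le (T : H →L[ℂ] H) : ‖onSystem n T‖ ≤ ‖T‖ :=
  LinearMap.mkContinuous_norm_le _ (norm_nonneg _) _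

theorem norm_onSystem_apply_le (T : H →L[ℂ] H) (x : Joint H n) :
    ‖onSystem n T x‖ ≤ ‖T‖ * ‖x‖ :=
  (onSystem n T).le_of_opNorm_le (norm_onSystem_le T) x

theorem onSystem_mul (S T : H →L[ℂ] H) (x : Joint H n) :
    onSystem n (S * T) x = onSystem n S (onSystem n T x) := rfl

/-- The vectors with no excitation in mode `j`. -/
def vacuumIn (H : Type*) [NormedAddCommGroup H] [InnerProductSpace ℂ H] {n : ℕ} (j : Fin n) :
    Submodule ℂ (Joint H n) where
  carrier := {x | ∀ k, k j ≠ 0 → x k = 0}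
  zero_mem' := fun _ _ => rfl
  add_mem' := by
    intro x y hx hy k hk
    rw [lp.coeFn_add, Pi.add_apply, hx k hk, hy k hk, add_zero]
  smul_mem' := by
    intro c x hx k hk
    rw [lp.coeFn_smul, Pi.smul_apply, hx k hk, smul_zero]

theorem isClosed_vacuumIn (j : Fin n) : IsClosed (vacuumIn H j : Set (Joint H n)) := by
  have : (vacuumIn H j : Set (Joint H n)) = ⋂ k, ⋂ _ : k j ≠ 0, {x | x k = 0} := by
    ext x
    simp only [Set.mem_iInter]
    rfl
  rw [this]
  exact isClosed_iInter fun k => isClosed_iInter fun _ => isClosed_setOf_coord_eq_zero k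

theorem vacuumIn_le_finiteExc (j : Fin n) : vacuumIn H j ≤ finiteExc H j :=
  fun _ hx => ⟨0, fun k hk => hx k hk.ne'⟩

theorem onSystem_mem_vacuumIn (T : H →L[ℂ] H) {j : Fin n} {x : Joint H n}
    (hx : x ∈ vacuumIn H j) : onSystem n T x ∈ vacuumIn H j := by
  intro k hk
  rw [onSystem_apply, hx k hk, map_zero]

theorem exp_mem_of_invariant {E : Type*} [NormedAddCommGroup E] [NormedSpace ℂ E] [CompleteSpace E]
    {p : Submodule ℂ E} (hp : IsClosed (p : Set E)) {B : E →L[ℂ] E} (hB : ∀ x ∈ p, B x ∈ p)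
    {x : E} (hx : x ∈ p) : NormedSpace.exp B x ∈ p := by
  have h := (NormedSpace.exp_series_hasSum_exp' (𝕂 := ℂ) B).mapL (ContinuousLinearMap.apply ℂ E x)
  refine hp.mem_of_tendsto h (Filter.Eventually.of_forall fun s => p.sum_mem fun m _ => ?_)
  change ((m.factorial : ℂ)⁻¹ • B ^ m) x ∈ p
  refine p.smul_mem _ ?_
  clear * - hx hB
  induction m with
  | zero => simpa using hx
  | succ m ih =>
    rw [pow_succ']
    exact hB _ ih

theorem single_mem_vacuumIn (ψ : H) (j : Fin n) :
    (lp.single 2 0 ψ : Joint H n) ∈ vacuumIn H j := by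
  intro k hk
  refine lp.single_apply_ne (E := fun _ : Fin n → ℕ => H) 2 0 ψ ?_
  rintro rfl
  exact hk rfl

variable [CompleteSpace H] (L : H →L[ℂ] H)

theorem onSystem_isSelfAdjoint {T : H →L[ℂ] H} (hT : IsSelfAdjoint T) :
    IsSelfAdjoint (onSystem n T) := by
  refine ContinuousLinearMap.isSelfAdjoint_iff'.mpr (Eq.symm ?_)
  rw [ContinuousLinearMap.eq_adjoint_iff]
  intro x y
  rw [inner_onSystem, ContinuousLinearMap.isSelfAdjoint_iff'.mp hT]

theorem coupling_apply (j : Fin n) (x : finiteExc H j) (k : Fin n → ℕ) :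
    ((coupling L j x : finiteExc H j) : Joint H n) k =
      L (((√(k j : ℝ) : ℝ) : ℂ) • (x : Joint H n) (down j k)) +
        L.adjoint (((√((k j : ℝ) + 1) : ℝ) : ℂ) • (x : Joint H n) (up j k)) := rfl

/-- Raising or lowering mode i leaves the occupation number of mode j unchanged. -/
theorem coupling_mem_vacuumIn {i j : Fin n} (hij : j ≠ i) (x : finiteExc H i)
    (hx : (x : Joint H n) ∈ vacuumIn H j) :
    ((coupling L i x : finiteExc H i) : Joint H n) ∈ vacuumIn H j := by
  intro k hk
  rw [coupling_apply, hx (down i k) (by rwa [down, Function.update_of_ne hij]),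
    hx (up i k) (by rwa [up, Function.update_of_ne hij])]
  simp

theorem expSeries_coupling_mem_vacuumIn {i j : Fin n} (hij : j ≠ i) (x : finiteExc H i)
    (hx : (x : Joint H n) ∈ vacuumIn H j) (z : ℂ) :
    expSeries (coupling L i) z x ∈ vacuumIn H j := by
  refine (isClosed_vacuumIn j).mem_of_tendsto (hasSum_expSeries (coupling_entire L i) z x)
    (Filter.Eventually.of_forall fun s => Submodule.sum_mem _ fun m _ =>
      Submodule.smul_mem _ _ ?_)
  clear * - hx hij
  induction m with
  | zero => simpa using hx
  | succ m ih =>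
    rw [pow_succ', Module.End.mul_apply]
    exact coupling_mem_vacuumIn L hij _ ih

/-- This turns the unitary, defined by choice, into a series in a scalar argument that contains √γ
as a factor; its dependence on the parameter can then be differentiated vector by vector. -/
theorem collisionUnitary_apply (γ δ : ℝ) (j : Fin n) (x : finiteExc H j) :
    collisionUnitary γ L δ j x = expSeries (coupling L j) (-Complex.I * (√δ * √γ : ℝ)) x := by
  refine (collisionUnitary_spec γ L δ j x).unique ?_
  convert hasSum_expSeries (coupling_entire L j) (-Complex.I * (√δ * √γ : ℝ)) x using 2 with m
  rw [interactionHamiltonian, smul_smul, ← Complex.ofReal_mul, smul_pow, LinearMap.smul_apply,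
    Submodule.coe_smul, smul_smul, mul_pow]
  congr 1
  ring

theorem norm_expSeries_coupling (j : Fin n) (a : ℝ) (ha : 0 ≤ a) (x : finiteExc H j) :
    ‖expSeries (coupling L j) (-Complex.I * a) x‖ = ‖(x : Joint H n)‖ := by
  -- Any a ≥ 0 is √δ √γ with δ = 1 and γ = a², so the isometry property is inherited from a
  -- collision.
  have h := collisionUnitary_apply L (a ^ 2) 1 j x
  rw [Real.sqrt_one, one_mul, Real.sqrt_sq ha] at h
  rw [← h, LinearIsometryEquiv.norm_map]

variable {j : Fin n} {x : finiteExc H j} (hx : (x : Joint H n) ∈ vacuumIn H j)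

include hx

/-- On an empty mode the annihilation half of the coupling vanishes and the creation half leaves
exactly one excitation. This and the next lemma record all components that matter. -/
theorem coupling_vacuum_apply_of_eq_zero {k : Fin n → ℕ} (hk : k j = 0) :
    ((coupling L j x : finiteExc H j) : Joint H n) k = 0 := by
  rw [coupling_apply, hx (up j k) (by rw [up_self]; omega), hk]
  simp

theorem coupling_vacuum_apply_up (k : Fin n → ℕ) :
    ((coupling L j x : finiteExc H j) : Joint H n) (up j k) = L ((x : Joint H n) k) := by
  rw [coupling_apply, hx (up j (up j k)) (by rw [up_self]; omega), down_up, up_self]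
  by_cases hk : k j = 0
  · simp [hk]
  · simp [hx k hk]

/-- Zero excitations are orthogonal to one. This removes the cross terms both from the QFI and from
the order √δ of the reduced dynamics. -/
theorem inner_coupling_vacuum {z : Joint H n} (hz : z ∈ vacuumIn H j) :
    ⟪z, ((coupling L j x : finiteExc H j) : Joint H n)⟫_ℂ = 0 := by
  rw [lp.inner_eq_tsum]
  refine (tsum_congr fun k => ?_).trans tsum_zero
  by_cases hk : k j = 0
  · rw [coupling_vacuum_apply_of_eq_zero L hx hk, inner_zero_right]
  · rw [hz k hk, inner_zero_left]

/-- The part of G²x with two excitations is invisible to z; what returns to the vacuum is L†L x.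
This is the origin of the anticommutator in the Lindblad generator. -/
theorem inner_coupling_coupling_vacuum {z : Joint H n} (hz : z ∈ vacuumIn H j) :
    ⟪z, ((coupling L j (coupling L j x) : finiteExc H j) : Joint H n)⟫_ℂ =
      ⟪z, onSystem n (L.adjoint * L) x⟫_ℂ := by
  rw [lp.inner_eq_tsum, lp.inner_eq_tsum]
  refine tsum_congr fun k => ?_
  by_cases hk : k j = 0
  · rw [coupling_apply, coupling_vacuum_apply_up L hx, hk, onSystem_apply]
    simp
  · rw [hz k hk, inner_zero_left, inner_zero_left]

/-- The emitted excitation only relabels the components of L x, so it drops out of the sum. This is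
the origin of the jump term L†XL. -/
theorem inner_coupling_vacuum_onSystem (X : H →L[ℂ] H) :
    ⟪((coupling L j x : finiteExc H j) : Joint H n),
      onSystem n X ((coupling L j x : finiteExc H j) : Joint H n)⟫_ℂ =
      ⟪(x : Joint H n), onSystem n (L.adjoint * X * L) x⟫_ℂ := by
  rw [lp.inner_eq_tsum, lp.inner_eq_tsum]
  rw [← (up_injective j).tsum_eq]
  · refine tsum_congr fun k => ?_
    rw [onSystem_apply, onSystem_apply, coupling_vacuum_apply_up L hx]
    exact (ContinuousLinearMap.adjoint_inner_right L _ _).symm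
  · intro k hk
    by_contra hk'
    refine hk ?_
    beta_reduce
    rw [coupling_vacuum_apply_of_eq_zero L hx (eq_zero_of_notMem_range_up j k hk'),
      inner_zero_left]

theorem norm_coupling_vacuum :
    ‖((coupling L j x : finiteExc H j) : Joint H n)‖ = ‖onSystem n L x‖ := by
  have h := inner_coupling_vacuum_onSystem L hx 1
  rw [@norm_eq_sqrt_re_inner ℂ, @norm_eq_sqrt_re_inner ℂ]
  rw [inner_onSystem L, ← onSystem_mul]
  rw [mul_one] at h
  rw [← h]
  rfl

end Vacuum

/-! ### Differentiation of the purification in the parameter, and its QFI for finite n. -/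

section Purification

variable {H : Type*} [NormedAddCommGroup H] [InnerProductSpace ℂ H] [CompleteSpace H]

/-- The derivative of a family of contractions applied to a family of vectors. -/
theorem hasDerivAt_contraction_apply {E : Type*} [NormedAddCommGroup E] [NormedSpace ℝ E]
    {W : ℝ → E →ₗ[ℝ] E} (hW : ∀ x y, ‖W x y‖ ≤ ‖y‖) {Φ : ℝ → E} {Φ' w' : E} {θ : ℝ}
    (hΦ : HasDerivAt Φ Φ' θ) (hw : HasDerivAt (fun x => W x (Φ θ)) w' θ)
    (hc : ContinuousAt (fun x => W x Φ') θ) :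
    HasDerivAt (fun x => W x (Φ x)) (W θ Φ' + w') θ := by
  rw [hasDerivAt_iff_isLittleO] at hΦ hw ⊢
  -- Only strong differentiability of W at the single vector Φ θ and strong continuity at Φ' are
  -- assumed; the uniform contraction bound controls W on the remainder of Φ.
  have h1 : (fun x => W x (Φ x - Φ θ - (x - θ) • Φ')) =o[nhds θ] fun x => x - θ :=
    (Asymptotics.isBigO_of_le _ fun x => hW x _).trans_isLittleO hΦ
  have h2 : (fun x => (x - θ) • (W x Φ' - W θ Φ')) =o[nhds θ] fun x => x - θ := by
    have h : (fun x => W x Φ' - W θ Φ') =o[nhds θ] fun _ => (1 : ℝ) := by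
      rw [Asymptotics.isLittleO_one_iff]
      simpa using hc.tendsto.sub_const (W θ Φ')
    simpa using (Asymptotics.isBigO_refl (fun x => x - θ) (nhds θ)).smul_isLittleO h
  refine ((h1.add h2).add hw).congr_left fun x => ?_
  simp only [map_sub, map_smul, smul_sub, smul_add]
  abel

variable {n : ℕ} (Hc : ℝ → H →L[ℂ] H) (L : H →L[ℂ] H) (δ : ℝ)

theorem jointEvolution_succ_apply (γ : ℝ) {i : ℕ} (hi : i < n) (x : Joint H n) :
    jointEvolution n Hc γ L δ (i + 1) x =
      NormedSpace.exp ((-(Complex.I * (δ : ℂ))) • onSystem n (Hc ((i + 1 : ℝ) * δ)))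
        (collisionUnitary γ L δ ⟨i, hi⟩ (jointEvolution n Hc γ L δ i x)) := by
  rw [jointEvolution, dif_pos hi]
  rfl

/-- The later bath modes are still in the vacuum. -/
theorem jointEvolution_mem_vacuumIn (γ : ℝ) (ψ : H) {i : ℕ} (hi : i ≤ n) :
    ∀ j : Fin n, i ≤ j → jointEvolution n Hc γ L δ i (lp.single 2 0 ψ) ∈ vacuumIn H j := by
  induction i with
  | zero => exact fun j _ => single_mem_vacuumIn ψ j
  | succ i ih =>
    intro j hj
    rw [jointEvolution_succ_apply Hc L δ γ hi]
    have hmem := ih (Nat.le_of_succ_le hi)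
    have hne : j ≠ ⟨i, hi⟩ := by
      rintro rfl
      simp at hj
    refine exp_mem_of_invariant (isClosed_vacuumIn j)
      (fun x hx => Submodule.smul_mem _ _ (onSystem_mem_vacuumIn _ hx)) ?_
    have h := collisionUnitary_apply L γ δ ⟨i, hi⟩
      ⟨_, vacuumIn_le_finiteExc _ (hmem ⟨i, hi⟩ le_rfl)⟩
    rw [h]
    exact expSeries_coupling_mem_vacuumIn L hne _ (hmem j (by omega)) _

theorem norm_jointEvolution (hHc : ∀ t : ℝ, 0 ≤ t → IsSelfAdjoint (Hc t)) (hδ : 0 ≤ δ) (γ : ℝ)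
    {i : ℕ} (hi : i ≤ n) (x : Joint H n) : ‖jointEvolution n Hc γ L δ i x‖ = ‖x‖ := by
  induction i with
  | zero => rfl
  | succ i ih =>
    rw [jointEvolution_succ_apply Hc L δ γ hi,
      norm_exp_apply (onSystem_isSelfAdjoint (hHc _ (by positivity))),
      LinearIsometryEquiv.norm_map, ih (Nat.le_of_succ_le hi)]

/-- The derivative of the joint state with respect to the parameter is orthogonal to the state, and
its squared norm is a sum of independent contributions of the collisions. -/
theorem exists_hasDerivAt_jointEvolution (hHc : ∀ t : ℝ, 0 ≤ t → IsSelfAdjoint (Hc t))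
    (hδ : 0 ≤ δ) {γ : ℝ → ℝ} {θ d : ℝ} (hγ : HasDerivAt (fun x => √(γ x)) d θ) (ψ : H)
    {i : ℕ} (hi : i ≤ n) : ∃ Φ' : Joint H n,
      HasDerivAt (fun x => jointEvolution n Hc (γ x) L δ i (lp.single 2 0 ψ)) Φ' θ ∧
      (∀ j : Fin n, i ≤ j → Φ' ∈ vacuumIn H j) ∧
      ⟪jointEvolution n Hc (γ θ) L δ i (lp.single 2 0 ψ), Φ'⟫_ℂ = 0 ∧
      ‖Φ'‖ ^ 2 = d ^ 2 * δ * ∑ l ∈ Finset.range i,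
        ‖onSystem n L (jointEvolution n Hc (γ θ) L δ l (lp.single 2 0 ψ))‖ ^ 2 := by
  -- That Φ' has its later modes empty is part of the induction: it puts Φ' in the domain of the
  -- next coupling and makes it orthogonal to the vector with one new excitation.
  induction i with
  | zero =>
    refine ⟨0, hasDerivAt_const _ _, fun j _ => Submodule.zero_mem _, inner_zero_right _, ?_⟩
    simp
  | succ i ih =>
    obtain ⟨Φ', hΦ, hvac, horth, hnorm⟩ := ih (Nat.le_of_succ_le hi)
    set j : Fin n := ⟨i, hi⟩ with hj
    have hmem := jointEvolution_mem_vacuumIn Hc L δ (γ θ) ψ (Nat.le_of_succ_le hi)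
    set Φ : ℝ → Joint H n := fun x => jointEvolution n Hc (γ x) L δ i (lp.single 2 0 ψ) with hΦdef
    set y : finiteExc H j := ⟨Φ θ, vacuumIn_le_finiteExc _ (hmem j le_rfl)⟩ with hy
    have hyv : (y : Joint H n) ∈ vacuumIn H j := hmem j le_rfl
    have hW : ∀ z : finiteExc H j, HasDerivAt (fun x => collisionUnitary (γ x) L δ j (z : Joint H n))
        ((-Complex.I * (√δ * d : ℝ)) •
          collisionUnitary (γ θ) L δ j (coupling L j z : finiteExc H j)) θ := by
      intro z
      simp_rw [collisionUnitary_apply]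
      refine (hasDerivAt_expSeries (coupling_entire L j) _ z).scomp θ ?_
      exact ((hγ.const_mul (√δ)).ofReal_comp).const_mul (-Complex.I)
    set c : ℂ := -Complex.I * (√δ * d : ℝ) with hc
    set B : Joint H n →L[ℂ] Joint H n := onSystem n (Hc ((i + 1 : ℝ) * δ)) with hB
    have hBsa : IsSelfAdjoint B := onSystem_isSelfAdjoint (hHc _ (by positivity))
    set V : Joint H n →L[ℂ] Joint H n := NormedSpace.exp ((-(Complex.I * (δ : ℂ))) • B) with hV
    set Gy : Joint H n := ((coupling L j y : finiteExc H j) : Joint H n) with hGy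
    have hstep : HasDerivAt (fun x => collisionUnitary (γ x) L δ j (Φ x))
        (collisionUnitary (γ θ) L δ j (Φ' + c • Gy)) θ := by
      -- The strong continuity required at Φ' holds because the collision is even differentiable on
      -- Φ', which lies in the domain.
      have h := hasDerivAt_contraction_apply
        (W := fun x => (collisionUnitary (γ x) L δ j).toLinearEquiv.toLinearMap.restrictScalars ℝ)
        (fun x z => (LinearIsometryEquiv.norm_map (collisionUnitary (γ x) L δ j) z).le) hΦ (hW y)
        (hW ⟨Φ', vacuumIn_le_finiteExc _ (hvac j le_rfl)⟩).continuousAt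
      refine h.congr_deriv ?_
      rw [map_add, map_smul]
      rfl
    refine ⟨V (collisionUnitary (γ θ) L δ j (Φ' + c • Gy)), ?_, ?_, ?_, ?_⟩
    · simp_rw [jointEvolution_succ_apply Hc L δ _ hi]
      exact ((V.restrictScalars ℝ).hasFDerivAt.comp_hasDerivAt θ hstep)
    · intro j' hj'
      have hne : j' ≠ j := by
        rintro rfl
        simp [hj] at hj'
      refine exp_mem_of_invariant (isClosed_vacuumIn j')
        (fun x hx => Submodule.smul_mem _ _ (onSystem_mem_vacuumIn _ hx)) ?_
      have h1 : Φ' ∈ vacuumIn H j' := hvac j' (by omega)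
      have h2 : Gy ∈ vacuumIn H j' := coupling_mem_vacuumIn L hne y (hmem j' (by omega))
      have h := collisionUnitary_apply L (γ θ) δ j (⟨Φ', vacuumIn_le_finiteExc _ (hvac j le_rfl)⟩ +
        c • coupling L j y)
      refine h ▸ expSeries_coupling_mem_vacuumIn L hne _ ?_ _
      exact Submodule.add_mem _ h1 (Submodule.smul_mem _ _ h2)
    · rw [jointEvolution_succ_apply Hc L δ _ hi, inner_exp_apply hBsa,
        LinearIsometryEquiv.inner_map_map, inner_add_right, horth, inner_smul_right,
        inner_coupling_vacuum L hyv hyv, mul_zero, add_zero]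
    -- Pythagoras: Φ' has mode j empty and c • Gy has one excitation there; |c|² = δ d².
    · rw [norm_exp_apply hBsa, LinearIsometryEquiv.norm_map, Finset.sum_range_succ, mul_add,
        ← hnorm, sq, norm_add_sq_eq_norm_sq_add_norm_sq_of_inner_eq_zero (𝕜 := ℂ), norm_smul,
        norm_coupling_vacuum L hyv, ← sq, ← sq, mul_pow]
      · congr 2
        rw [hc, norm_mul, norm_neg, Complex.norm_I, one_mul, Complex.norm_real, Real.norm_eq_abs,
          sq_abs, mul_pow, Real.sq_sqrt hδ, mul_comm]
      · rw [inner_smul_right, inner_coupling_vacuum L hyv (hvac j le_rfl), mul_zero]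

/-- The quantum Fisher information of the collisional purification with finitely many collisions. -/
theorem hasPureQFI_purification (hHc : ∀ t : ℝ, 0 ≤ t → IsSelfAdjoint (Hc t)) {γ : ℝ → ℝ}
    {θ d : ℝ} (hγ : HasDerivAt (fun x => √(γ x)) d θ) (ψ : H) {t : ℝ} (ht : 0 ≤ t) (n : ℕ) :
    HasPureQFI (fun x => purification Hc (γ x) L ψ t n) θ
      (4 * (d ^ 2 * (t / n) * ∑ l ∈ Finset.range n,
        ‖onSystem n L (jointEvolution n Hc (γ θ) L (t / n) l (lp.single 2 0 ψ))‖ ^ 2)) := by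
  obtain ⟨Φ', h1, -, h3, h4⟩ := exists_hasDerivAt_jointEvolution Hc L (t / n) hHc (by positivity)
    hγ ψ (le_refl n)
  refine ⟨Φ', h1, ?_⟩
  change _ = 4 * (_ - ‖⟪jointEvolution n Hc (γ θ) L (t / n) n (lp.single 2 0 ψ), Φ'⟫_ℂ‖ ^ 2)
  rw [h3, h4]
  simp

end Purification

/-! ### Reduced states as functionals, and the generator in the Heisenberg picture. -/

section Heisenberg

section

variable {H : Type*} [NormedAddCommGroup H] [InnerProductSpace ℂ H]

/-- The functional `X ↦ ⟨Ψ| X ⊗ 1 |Ψ⟩`. -/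
noncomputable def reducedState {n : ℕ} (Ψ : Joint H n) : (H →L[ℂ] H) →L[ℂ] ℂ :=
  LinearMap.mkContinuous
    { toFun := fun X => ⟪Ψ, onSystem n X Ψ⟫_ℂ
      map_add' := fun X Y => inner_add_right Ψ (onSystem n X Ψ) (onSystem n Y Ψ)
      map_smul' := fun c X => inner_smul_right Ψ (onSystem n X Ψ) c } (‖Ψ‖ ^ 2) (fun X => by
      refine (norm_inner_le_norm (𝕜 := ℂ) Ψ (onSystem n X Ψ)).trans ?_
      calc _ ≤ ‖Ψ‖ * (‖X‖ * ‖Ψ‖) := by gcongr; exact norm_onSystem_apply_le X Ψ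
        _ = _ := by ring)

theorem reducedState_apply {n : ℕ} (Ψ : Joint H n) (X : H →L[ℂ] H) :
    reducedState Ψ X = ⟪Ψ, onSystem n X Ψ⟫_ℂ := rfl

end

variable {H : Type*} [NormedAddCommGroup H] [InnerProductSpace ℂ H] [CompleteSpace H]

/-- The Lindblad generator in the Heisenberg picture,
`X ↦ i [K, X] + γ (L† X L - {L† L, X} / 2)`. -/
noncomputable def heisenbergGenerator (γ : ℝ) (L K : H →L[ℂ] H) :
    (H →L[ℂ] H) →L[ℂ] (H →L[ℂ] H) :=
  Complex.I • (ContinuousLinearMap.mul ℂ (H →L[ℂ] H) K -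
      (ContinuousLinearMap.mul ℂ (H →L[ℂ] H)).flip K) +
    (γ : ℂ) • ((ContinuousLinearMap.mul ℂ (H →L[ℂ] H)).flip L ∘L
        ContinuousLinearMap.mul ℂ (H →L[ℂ] H) L.adjoint -
      (1 / 2 : ℂ) • (ContinuousLinearMap.mul ℂ (H →L[ℂ] H) (L.adjoint * L) +
        (ContinuousLinearMap.mul ℂ (H →L[ℂ] H)).flip (L.adjoint * L)))

theorem heisenbergGenerator_apply (γ : ℝ) (L K X : H →L[ℂ] H) :
    heisenbergGenerator γ L K X = Complex.I • (K * X - X * K) +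
      (γ : ℂ) • (L.adjoint * X * L -
        (1 / 2 : ℂ) • (L.adjoint * L * X + X * (L.adjoint * L))) := rfl

theorem continuous_heisenbergGenerator (γ : ℝ) (L : H →L[ℂ] H) :
    Continuous (heisenbergGenerator γ L) := by
  unfold heisenbergGenerator
  fun_prop

theorem reducedState_adjoint_mul_self {n : ℕ} (Ψ : Joint H n) (L : H →L[ℂ] H) :
    reducedState Ψ (L.adjoint * L) = ((‖onSystem n L Ψ‖ ^ 2 : ℝ) : ℂ) := by
  rw [reducedState_apply, onSystem_mul, ← inner_onSystem, inner_self_eq_norm_sq_to_K]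
  push_cast
  rfl

end Heisenberg

/-! ### One collision as an Euler step of the master equation. -/

section LocalError

/-- Here η carries the amplitude of order σ, ζ that of order σ², and r the rest. The two
orthogonality hypotheses cancel order σ, the subtracted bracket is order σ², and every other product
has at least a factor σ³; surplus powers of σ are absorbed by S. -/
theorem norm_quadratic_expansion_le {E : Type*} [NormedAddCommGroup E] [InnerProductSpace ℂ E]
    {P : E →L[ℂ] E} {x η ζ r : E} {σ S a b c : ℝ} (hx : ‖x‖ = 1) (hxη : ⟪x, P η⟫_ℂ = 0)
    (hηx : ⟪η, P x⟫_ℂ = 0) (hσ : 0 ≤ σ) (hσS : σ ≤ S) (hη : ‖η‖ ≤ σ * a) (hζ : ‖ζ‖ ≤ b)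
    (hr : ‖r‖ ≤ σ ^ 3 * c) (hc : 0 ≤ c) :
    ‖⟪x + η + ((σ ^ 2 : ℝ) : ℂ) • ζ + r, P (x + η + ((σ ^ 2 : ℝ) : ℂ) • ζ + r)⟫_ℂ - ⟪x, P x⟫_ℂ -
      (⟪η, P η⟫_ℂ + ((σ ^ 2 : ℝ) : ℂ) * (⟪x, P ζ⟫_ℂ + ⟪ζ, P x⟫_ℂ))‖ ≤
      σ ^ 3 * (2 * c + 2 * a * (b + S * c) + S * (b + S * c) ^ 2) * ‖P‖ := by
  have hb : 0 ≤ b := (norm_nonneg _).trans hζ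
  have hS : 0 ≤ S := hσ.trans hσS
  set w : E := ((σ ^ 2 : ℝ) : ℂ) • ζ + r with hw
  have hwn : ‖w‖ ≤ σ ^ 2 * (b + S * c) := by
    refine (norm_add_le _ _).trans ?_
    rw [norm_smul, Complex.norm_real, Real.norm_of_nonneg (by positivity)]
    calc _ ≤ σ ^ 2 * b + σ ^ 2 * (σ * c) := by
          gcongr
          refine hr.trans (le_of_eq ?_)
          ring
      _ ≤ σ ^ 2 * b + σ ^ 2 * (S * c) := by gcongr
      _ = _ := by ring
  have hdec : ⟪x + η + ((σ ^ 2 : ℝ) : ℂ) • ζ + r, P (x + η + ((σ ^ 2 : ℝ) : ℂ) • ζ + r)⟫_ℂ -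
      ⟪x, P x⟫_ℂ - (⟪η, P η⟫_ℂ + ((σ ^ 2 : ℝ) : ℂ) * (⟪x, P ζ⟫_ℂ + ⟪ζ, P x⟫_ℂ)) =
      ⟪x, P r⟫_ℂ + ⟪r, P x⟫_ℂ + ⟪η, P w⟫_ℂ + ⟪w, P η⟫_ℂ + ⟪w, P w⟫_ℂ := by
    simp only [hw, map_add, map_smul, inner_add_left, inner_add_right, inner_smul_left,
      inner_smul_right, Complex.conj_ofReal, hxη, hηx]
    ring
  have hin : ∀ u v : E, ∀ p q : ℝ, ‖u‖ ≤ p → ‖v‖ ≤ q → ‖⟪u, P v⟫_ℂ‖ ≤ p * q * ‖P‖ := by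
    intro u v p q hu hv
    refine (norm_inner_le_norm _ _).trans ?_
    have hp : 0 ≤ p := (norm_nonneg _).trans hu
    calc ‖u‖ * ‖P v‖ ≤ p * (‖P‖ * q) := by
          gcongr
          exact (P.le_opNorm v).trans (by gcongr)
      _ = _ := by ring
  rw [hdec]
  have h1 := hin x r 1 _ hx.le hr
  have h2 := hin r x _ 1 hr hx.le
  have h3 := hin η w _ _ hη hwn
  have h4 := hin w η _ _ hwn hη
  have h5 := hin w w _ _ hwn hwn
  have h6 : σ ^ 2 * (b + S * c) * (σ ^ 2 * (b + S * c)) * ‖P‖ ≤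
      σ ^ 3 * (S * (b + S * c) ^ 2) * ‖P‖ := by
    calc _ = σ ^ 3 * (σ * (b + S * c) ^ 2) * ‖P‖ := by ring
      _ ≤ _ := by gcongr
  have h7 := norm_add_le (⟪x, P r⟫_ℂ + ⟪r, P x⟫_ℂ + ⟪η, P w⟫_ℂ + ⟪w, P η⟫_ℂ) ⟪w, P w⟫_ℂ
  have h8 := norm_add_le (⟪x, P r⟫_ℂ + ⟪r, P x⟫_ℂ + ⟪η, P w⟫_ℂ) ⟪w, P η⟫_ℂ
  have h9 := norm_add_le (⟪x, P r⟫_ℂ + ⟪r, P x⟫_ℂ) ⟪η, P w⟫_ℂ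
  have h10 := norm_add_le ⟪x, P r⟫_ℂ ⟪r, P x⟫_ℂ
  calc _ ≤ 1 * (σ ^ 3 * c) * ‖P‖ + σ ^ 3 * c * 1 * ‖P‖ + σ * a * (σ ^ 2 * (b + S * c)) * ‖P‖ +
        σ ^ 2 * (b + S * c) * (σ * a) * ‖P‖ + σ ^ 3 * (S * (b + S * c) ^ 2) * ‖P‖ := by linarith
    _ = _ := by ring

variable {H : Type*} [NormedAddCommGroup H] [InnerProductSpace ℂ H] [CompleteSpace H]

/-- From the vacuum, the three couplings meet at most 0, 1 and 2 excitations, so each costs at most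
2‖L‖√3 ≤ 4‖L‖ + 1. The constant is independent of n and j, as a uniform step error requires. -/
theorem exists_norm_coupling_pow_le (L : H →L[ℂ] H) : ∃ c : ℝ, 0 ≤ c ∧
    ∀ {n : ℕ} {j : Fin n} (x : finiteExc H j), (x : Joint H n) ∈ vacuumIn H j →
      ‖(x : Joint H n)‖ = 1 →
      ‖((coupling L j x : finiteExc H j) : Joint H n)‖ ≤ c ∧
      ‖((coupling L j (coupling L j x) : finiteExc H j) : Joint H n)‖ ≤ c ∧
      ‖((coupling L j (coupling L j (coupling L j x)) : finiteExc H j) : Joint H n)‖ ≤ c := by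
  set l : ℝ := 4 * ‖L‖ + 1 with hl
  have hl1 : 1 ≤ l := by have := norm_nonneg L; linarith
  have hroot : ∀ M : ℕ, M ≤ 2 → 2 * ‖L‖ * √((M : ℝ) + 1) ≤ l := by
    intro M hM
    have : √((M : ℝ) + 1) ≤ 2 := by
      rw [Real.sqrt_le_left (by norm_num)]
      have : (M : ℝ) ≤ 2 := by exact_mod_cast hM
      linarith
    have := mul_le_mul_of_nonneg_left this (show 0 ≤ 2 * ‖L‖ by positivity)
    linarith
  refine ⟨l ^ 3, by positivity, fun {n j} x hx hx1 => ?_⟩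
  obtain ⟨e1, b1⟩ := coupling_bound L j x (M := 0) (fun k hk => hx k hk.ne')
  obtain ⟨e2, b2⟩ := coupling_bound L j _ e1
  obtain ⟨-, b3⟩ := coupling_bound L j _ e2
  rw [hx1] at b1
  have c1 : ‖((coupling L j x : finiteExc H j) : Joint H n)‖ ≤ l :=
    b1.trans (by simpa using hroot 0 (by norm_num))
  have c2 : ‖((coupling L j (coupling L j x) : finiteExc H j) : Joint H n)‖ ≤ l * l :=
    b2.trans (mul_le_mul (hroot _ (by norm_num)) c1 (norm_nonneg _) (by positivity))
  have c3 : ‖((coupling L j (coupling L j (coupling L j x)) : finiteExc H j) : Joint H n)‖ ≤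
      l * (l * l) :=
    b3.trans (mul_le_mul (hroot _ (by norm_num)) c2 (norm_nonneg _) (by positivity))
  refine ⟨c1.trans ?_, c2.trans ?_, c3.trans (le_of_eq (by ring))⟩
  · exact le_self_pow₀ hl1 (by norm_num)
  · rw [← sq]
    exact pow_le_pow_right₀ hl1 (by norm_num)

set_option maxHeartbeats 1000000 in
/-- One collision advances the reduced state by an Euler step of the master equation, up to an error
of order `δ ^ (3 / 2)`. -/
theorem exists_local_error (γ : ℝ) (hγ : 0 ≤ γ) (L : H →L[ℂ] H) (M T : ℝ) :
    ∃ C : ℝ, ∀ {n : ℕ} (j : Fin n) (δ : ℝ), 0 ≤ δ → δ ≤ T → ∀ K : H →L[ℂ] H, IsSelfAdjoint K →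
      ‖K‖ ≤ M → ∀ x ∈ vacuumIn H j, ‖x‖ = 1 →
      ‖reducedState (NormedSpace.exp ((-(Complex.I * (δ : ℂ))) • onSystem n K)
          (collisionUnitary γ L δ j x)) - reducedState x -
        δ • (reducedState x ∘L heisenbergGenerator γ L K)‖ ≤ δ * (C * √δ) := by
  obtain ⟨c, hc, hcoup⟩ := exists_norm_coupling_pow_le L
  set s : ℝ := √γ with hs
  have hs0 : 0 ≤ s := Real.sqrt_nonneg _
  have hs2 : s ^ 2 = γ := Real.sq_sqrt hγ
  set S : ℝ := √T with hS
  -- These bound ‖η‖/σ, ‖ζ‖ and ‖r‖/σ³ below. The summands of e come from the second order of the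
  -- control exponential, from the control acting on the first collision increment, and from the
  -- third order of the collision.
  set a : ℝ := s * c with ha
  set b : ℝ := γ * c + |M| with hb
  set e : ℝ := S * M ^ 2 + |M| * s * c + s ^ 3 * c with he
  have hS0 : 0 ≤ S := Real.sqrt_nonneg _
  refine ⟨2 * e + 2 * a * (b + S * e) + S * (b + S * e) ^ 2, ?_⟩
  intro n j δ hδ hδT K hK hKM x hxv hx1
  set σ : ℝ := √δ with hσ
  have hσ0 : 0 ≤ σ := Real.sqrt_nonneg _
  have hσ2 : σ ^ 2 = δ := Real.sq_sqrt hδ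
  have hσS : σ ≤ S := Real.sqrt_le_sqrt hδT
  have hM0 : 0 ≤ M := (norm_nonneg _).trans hKM
  set x' : finiteExc H j := ⟨x, vacuumIn_le_finiteExc _ hxv⟩ with hx'
  have hxv' : (x' : Joint H n) ∈ vacuumIn H j := hxv
  obtain ⟨hG1, hG2, hG3⟩ := hcoup x' hxv hx1
  set B : Joint H n →L[ℂ] Joint H n := onSystem n K with hB
  have hBsa : IsSelfAdjoint B := onSystem_isSelfAdjoint hK
  have hBM : ‖B‖ ≤ M := (norm_onSystem_le K).trans hKM
  set y : Joint H n := collisionUnitary γ L δ j x with hy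
  have hy1 : ‖y‖ = 1 := by rw [hy, LinearIsometryEquiv.norm_map, hx1]
  have hyexp : y = expSeries (coupling L j) (-Complex.I * (σ * s : ℝ)) x' :=
    collisionUnitary_apply L γ δ j x'
  have hσs : 0 ≤ σ * s := by positivity
  set G1 : Joint H n := ((coupling L j x' : finiteExc H j) : Joint H n) with hG1d
  set G2 : Joint H n := ((coupling L j (coupling L j x') : finiteExc H j) : Joint H n) with hG2d
  have ht1 : ‖y - x‖ ≤ σ * s * c := by
    have h := norm_expSeries_sub_taylor_le (coupling_entire L j) (norm_expSeries_coupling L j) 1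
      x' (σ * s) hσs
    rw [← hyexp] at h
    simp only [Finset.sum_range_one, pow_zero, pow_one, Nat.factorial_zero, Nat.cast_one, div_one,
      one_smul, Module.End.one_apply] at h
    exact h.trans (by gcongr)
  have ht3 : ‖y - (x + (-Complex.I * (σ * s : ℝ)) • G1 +
      ((-Complex.I * (σ * s : ℝ)) ^ 2 / 2) • G2)‖ ≤ (σ * s) ^ 3 * c := by
    have h := norm_expSeries_sub_taylor_le (coupling_entire L j) (norm_expSeries_coupling L j) 3
      x' (σ * s) hσs
    rw [← hyexp] at h
    simp only [Finset.sum_range_succ, Finset.sum_range_zero, zero_add, pow_zero, pow_one,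
      Nat.factorial, Nat.cast_one, div_one, one_smul, Module.End.one_apply, mul_one] at h
    exact h.trans (by gcongr; exact hG3)
  set η : Joint H n := (-Complex.I * (σ * s : ℝ)) • G1 with hη
  -- The amplitude of order δ: second order in the collision, first order in the control.
  set ζ : Joint H n := -((γ / 2 : ℂ) • G2) - Complex.I • B x with hζ
  set v : Joint H n := NormedSpace.exp ((-(Complex.I * (δ : ℂ))) • B) y with hv
  set r : Joint H n := v - (x + η + ((σ ^ 2 : ℝ) : ℂ) • ζ) with hr
  have hsq : (-Complex.I * (σ * s : ℝ)) ^ 2 / 2 = -(((σ ^ 2 : ℝ) : ℂ) * (γ / 2 : ℂ)) := by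
    rw [mul_pow, neg_sq, Complex.I_sq, ← hs2]
    push_cast
    ring
  have hrn : ‖r‖ ≤ σ ^ 3 * e := by
    have hrdec : r = (v - y + (δ : ℂ) • Complex.I • B y) -
        (δ : ℂ) • Complex.I • B (y - x) +
        (y - (x + η + ((-Complex.I * (σ * s : ℝ)) ^ 2 / 2) • G2)) := by
      rw [hsq, hr, hζ, hσ2, map_sub]
      module
    have h1 : ‖v - y + (δ : ℂ) • Complex.I • B y‖ ≤ δ ^ 2 * M ^ 2 := by
      refine (norm_exp_apply_sub_sub_le hBsa y hδ).trans ?_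
      rw [hy1, mul_one]
      gcongr
    have h2 : ‖(δ : ℂ) • Complex.I • B (y - x)‖ ≤ δ * (M * (σ * s * c)) := by
      rw [norm_smul, norm_smul, Complex.norm_I, one_mul, Complex.norm_real,
        Real.norm_of_nonneg hδ]
      gcongr
      exact (B.le_opNorm _).trans (by gcongr)
    rw [hrdec]
    refine (norm_add_le _ _).trans ((add_le_add ((norm_sub_le _ _).trans (add_le_add h1 h2))
      ht3).trans ?_)
    have h3 : δ ^ 2 * M ^ 2 ≤ σ ^ 3 * (S * M ^ 2) := by
      rw [← hσ2]
      calc _ = σ ^ 3 * (σ * M ^ 2) := by ring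
        _ ≤ _ := by gcongr
    have h4 : δ * (M * (σ * s * c)) = σ ^ 3 * (|M| * s * c) := by
      rw [← hσ2, abs_of_nonneg hM0]; ring
    rw [h4, he]
    calc _ ≤ σ ^ 3 * (S * M ^ 2) + σ ^ 3 * (|M| * s * c) + (σ * s) ^ 3 * c := by gcongr
      _ = _ := by ring
  have hvdec : v = x + η + ((σ ^ 2 : ℝ) : ℂ) • ζ + r := by rw [hr]; abel
  refine ContinuousLinearMap.opNorm_le_bound _ ?_ fun X => ?_
  · positivity
  have hPx : onSystem n X x ∈ vacuumIn H j := onSystem_mem_vacuumIn X hxv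
  have hadj : ∀ u w : Joint H n, ⟪u, onSystem n X w⟫_ℂ = ⟪onSystem n X.adjoint u, w⟫_ℂ := by
    intro u w
    rw [inner_onSystem, ContinuousLinearMap.adjoint_adjoint]
  have hxη : ⟪x, onSystem n X η⟫_ℂ = 0 := by
    rw [hadj, hη, inner_smul_right, inner_coupling_vacuum L hxv' (onSystem_mem_vacuumIn _ hxv),
      mul_zero]
  have hηx : ⟪η, onSystem n X x⟫_ℂ = 0 := by
    rw [← inner_conj_symm, hη, inner_smul_right, inner_coupling_vacuum L hxv' hPx, mul_zero,
      map_zero]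
  have hηn : ‖η‖ ≤ σ * a := by
    rw [hη, norm_smul, norm_mul, norm_neg, Complex.norm_I, one_mul, Complex.norm_real,
      Real.norm_of_nonneg hσs, ha, ← mul_assoc]
    gcongr
  have hζn : ‖ζ‖ ≤ b := by
    refine (norm_sub_le _ _).trans (add_le_add ?_ ?_)
    · rw [norm_neg, norm_smul, norm_div, Complex.norm_real, Real.norm_of_nonneg hγ]
      have : γ / ‖(2 : ℂ)‖ ≤ γ := by
        rw [Complex.norm_ofNat]
        linarith
      gcongr
    · rw [norm_smul, Complex.norm_I, one_mul, abs_of_nonneg hM0]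
      refine (B.le_opNorm x).trans ?_
      rw [hx1, mul_one]
      exact hBM
  have main := norm_quadratic_expansion_le hx1 hxη hηx hσ0 hσS hηn hζn hrn (by positivity)
  rw [← hvdec] at main
  have hηη : ⟪η, onSystem n X η⟫_ℂ =
      ((σ ^ 2 : ℝ) : ℂ) * (γ * reducedState x (L.adjoint * X * L)) := by
    have hcc : starRingEnd ℂ (-Complex.I * (σ * s : ℝ)) * (-Complex.I * (σ * s : ℝ)) =
        ((σ ^ 2 : ℝ) : ℂ) * γ := by
      rw [map_mul, map_neg, Complex.conj_I, Complex.conj_ofReal, ← hs2]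
      push_cast
      linear_combination (-(σ : ℂ) ^ 2 * (s : ℂ) ^ 2) * Complex.I_sq
    rw [hη, map_smul, inner_smul_left, inner_smul_right, hG1d,
      inner_coupling_vacuum_onSystem L hxv', ← mul_assoc, hcc, mul_assoc]
    rfl
  have hxζ : ⟪x, onSystem n X ζ⟫_ℂ = -(γ / 2 * reducedState x (X * (L.adjoint * L))) -
      Complex.I * reducedState x (X * K) := by
    rw [hζ, hadj, inner_sub_right, inner_neg_right, inner_smul_right, inner_smul_right, hG2d,
      inner_coupling_coupling_vacuum L hxv' (onSystem_mem_vacuumIn _ hxv), ← hadj, ← hadj]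
    rfl
  have hζx : ⟪ζ, onSystem n X x⟫_ℂ = -(γ / 2 * reducedState x (L.adjoint * L * X)) +
      Complex.I * reducedState x (K * X) := by
    have h1 : ⟪G2, onSystem n X x⟫_ℂ = reducedState x (L.adjoint * L * X) := by
      rw [← inner_conj_symm, hG2d, inner_coupling_coupling_vacuum L hxv' hPx, inner_conj_symm,
        inner_onSystem, reducedState_apply, onSystem_mul]
      congr 3
      rw [← ContinuousLinearMap.star_eq_adjoint, ← ContinuousLinearMap.star_eq_adjoint]
      simp
    have h2 : ⟪B x, onSystem n X x⟫_ℂ = reducedState x (K * X) := by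
      rw [hB, inner_onSystem, ContinuousLinearMap.isSelfAdjoint_iff'.mp hK]
      rfl
    rw [hζ, inner_sub_left, inner_neg_left, inner_smul_left, inner_smul_left, h1, h2]
    have h3 : starRingEnd ℂ (γ / 2 : ℂ) = γ / 2 := by simp [Complex.conj_ofNat]
    rw [h3, Complex.conj_I]
    ring
  have hgen : ((σ ^ 2 : ℝ) : ℂ) * (γ * reducedState x (L.adjoint * X * L)) +
      ((σ ^ 2 : ℝ) : ℂ) * (⟪x, onSystem n X ζ⟫_ℂ + ⟪ζ, onSystem n X x⟫_ℂ) =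
      (δ • (reducedState x ∘L heisenbergGenerator γ L K)) X := by
    rw [hxζ, hζx, hσ2, smul_apply, ContinuousLinearMap.comp_apply,
      heisenbergGenerator_apply]
    simp only [map_add, map_sub, map_smul, smul_eq_mul, Complex.real_smul]
    ring
  rw [hηη, hgen] at main
  refine main.trans ?_
  have hd : δ * σ = σ ^ 3 := by rw [← hσ2]; ring
  calc _ ≤ σ ^ 3 * (2 * e + 2 * a * (b + S * e) + S * (b + S * e) ^ 2) * ‖X‖ :=
        mul_le_mul_of_nonneg_left (norm_onSystem_le X) (by positivity)
    _ = _ := by rw [← hd]; ring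

end LocalError

/-! ### Normal functionals on the bounded operators. -/

section Normal

variable {H ι : Type*} [NormedAddCommGroup H] [InnerProductSpace ℂ H]

/-- A functional on the bounded operators is normal with respect to the basis `e` if it is the sum
of its restrictions along the projections onto the basis vectors. -/
def IsNormalIn (e : HilbertBasis ι ℂ H) (f : (H →L[ℂ] H) →L[ℂ] ℂ) : Prop :=
  ∀ X : H →L[ℂ] H, HasSum (fun i => f (InnerProductSpace.rankOne ℂ (e i) (e i) * X)) (f X)

/-- The projection onto the span of finitely many basis vectors. -/
noncomputable def basisProjection (e : HilbertBasis ι ℂ H) (S : Finset ι) : H →L[ℂ] H :=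
  ∑ i ∈ S, InnerProductSpace.rankOne ℂ (e i) (e i)

theorem basisProjection_apply (e : HilbertBasis ι ℂ H) (S : Finset ι) (x : H) :
    basisProjection e S x = ∑ i ∈ S, ⟪e i, x⟫_ℂ • e i := by
  simp [basisProjection]

theorem norm_basisProjection_apply_le (e : HilbertBasis ι ℂ H) (S : Finset ι) (x : H) :
    ‖basisProjection e S x‖ ≤ ‖x‖ := by
  refine (sq_le_sq₀ (norm_nonneg _) (norm_nonneg _)).mp ?_
  refine le_trans (le_of_eq ?_) (e.orthonormal.sum_inner_products_le x (s := S))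
  rw [← Complex.ofReal_inj, Complex.ofReal_pow]
  have h := inner_self_eq_norm_sq_to_K (𝕜 := ℂ) (basisProjection e S x)
  rw [basisProjection_apply, e.orthonormal.inner_sum] at h
  rw [basisProjection_apply]
  refine h.symm.trans ?_
  push_cast
  exact Finset.sum_congr rfl fun i _ => Complex.conj_mul' _

theorem norm_basisProjection_mul_le (e : HilbertBasis ι ℂ H) (S : Finset ι) (X : H →L[ℂ] H) :
    ‖basisProjection e S * X‖ ≤ ‖X‖ :=
  ContinuousLinearMap.opNorm_le_bound _ (norm_nonneg _) fun x =>
    (norm_basisProjection_apply_le e S (X x)).trans (X.le_opNorm x)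

theorem isNormalIn_iff (e : HilbertBasis ι ℂ H) (f : (H →L[ℂ] H) →L[ℂ] ℂ) :
    IsNormalIn e f ↔ ∀ X : H →L[ℂ] H,
      Filter.Tendsto (fun S => f (basisProjection e S * X)) Filter.atTop (nhds (f X)) := by
  refine forall_congr' fun X => ?_
  have : ∀ S : Finset ι, f (basisProjection e S * X) =
      ∑ i ∈ S, f (InnerProductSpace.rankOne ℂ (e i) (e i) * X) := by
    intro S
    rw [basisProjection, Finset.sum_mul, map_sum]
  simp_rw [this]
  rfl

/-- Multiplication by a basis projection does not increase norms, so norm convergence of the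
functionals is uniform over all finite projections, and an ε/3 argument applies. -/
theorem IsNormalIn.of_tendsto {e : HilbertBasis ι ℂ H} {g : ℕ → (H →L[ℂ] H) →L[ℂ] ℂ}
    {f : (H →L[ℂ] H) →L[ℂ] ℂ} (hg : ∀ n, IsNormalIn e (g n))
    (hgf : Filter.Tendsto g Filter.atTop (nhds f)) : IsNormalIn e f := by
  rw [isNormalIn_iff]
  intro X
  rw [Metric.tendsto_nhds]
  intro ε hε
  have h1 := ((tendsto_iff_norm_sub_tendsto_zero (E := (H →L[ℂ] H) →L[ℂ] ℂ)).mp hgf).mul_const ‖X‖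
  rw [zero_mul] at h1
  obtain ⟨n, hn⟩ := (h1.eventually (gt_mem_nhds (show 0 < ε / 3 by positivity))).exists
  filter_upwards [Metric.tendsto_nhds.mp ((isNormalIn_iff e (g n)).mp (hg n) X) (ε / 3)
    (by positivity)] with S hS
  rw [dist_eq_norm] at hS ⊢
  have h2 : ‖(g n - f) X‖ ≤ ‖g n - f‖ * ‖X‖ := (g n - f).le_opNorm X
  have h3 : ‖(g n - f) (basisProjection e S * X)‖ ≤ ‖g n - f‖ * ‖X‖ :=
    ((g n - f).le_opNorm _).trans (by gcongr; exact norm_basisProjection_mul_le e S X)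
  have h4 : f (basisProjection e S * X) - f X = (g n (basisProjection e S * X) - g n X) +
      (g n - f) X - (g n - f) (basisProjection e S * X) := by
    simp only [sub_apply]
    ring
  rw [h4]
  have h5 := norm_sub_le ((g n (basisProjection e S * X) - g n X) + (g n - f) X)
    ((g n - f) (basisProjection e S * X))
  have h6 := norm_add_le (g n (basisProjection e S * X) - g n X) ((g n - f) X)
  linarith

/-- Parseval's identity in each component of Ψ, then dominated convergence over the occupation
numbers with majorant ‖Ψ k‖² ‖X‖. -/
theorem isNormalIn_reducedState (e : HilbertBasis ι ℂ H) {n : ℕ} (Ψ : Joint H n) :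
    IsNormalIn e (reducedState Ψ) := by
  rw [isNormalIn_iff]
  intro X
  simp_rw [reducedState_apply, lp.inner_eq_tsum]
  have hsum : Summable fun k => ‖Ψ k‖ ^ 2 * ‖X‖ := (summable_sq Ψ).mul_right _
  refine tendsto_tsum_of_dominated_convergence hsum (fun k => ?_)
    (Filter.Eventually.of_forall fun S k => ?_)
  · have h := e.hasSum_inner_mul_inner (Ψ k) (X (Ψ k))
    refine Filter.Tendsto.congr (fun S => ?_) h
    change _ = ⟪Ψ k, basisProjection e S (X (Ψ k))⟫_ℂ
    rw [basisProjection_apply, inner_sum]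
    exact Finset.sum_congr rfl fun i _ => by rw [inner_smul_right, mul_comm]
  · refine (norm_inner_le_norm _ _).trans ?_
    change _ * ‖basisProjection e S (X (Ψ k))‖ ≤ _
    calc _ ≤ ‖Ψ k‖ * (‖X‖ * ‖Ψ k‖) := by
          gcongr
          exact (norm_basisProjection_apply_le e S _).trans (X.le_opNorm _)
      _ = _ := by ring

theorem reducedState_single {n : ℕ} (ψ : H) (X : H →L[ℂ] H) :
    reducedState (lp.single 2 0 ψ : Joint H n) X = ⟪ψ, X ψ⟫_ℂ := by
  rw [reducedState_apply, lp.inner_eq_tsum, tsum_eq_single 0]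
  · rw [onSystem_apply, lp.single_apply_self]
  · intro k hk
    rw [lp.single_apply_ne (E := fun _ : Fin n → ℕ => H) 2 0 ψ hk, inner_zero_left]

end Normal

/-! ### Density operators of functionals, and uniqueness for the Lindblad equation. -/

section Identification

variable {H : Type*} [NormedAddCommGroup H] [InnerProductSpace ℂ H]

theorem mul_rankOne (w v : H) (K : H →L[ℂ] H) :
    K * InnerProductSpace.rankOne ℂ w v = InnerProductSpace.rankOne ℂ (K w) v := by
  ext x
  simp

theorem ext_inner_operator {S T : H →L[ℂ] H} (h : ∀ v w, ⟪v, S w⟫_ℂ = ⟪v, T w⟫_ℂ) : S = T :=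
  ContinuousLinearMap.ext fun w => ext_inner_left ℂ fun v => h v w

variable [CompleteSpace H]

theorem rankOne_mul (w v : H) (K : H →L[ℂ] H) :
    InnerProductSpace.rankOne ℂ w v * K = InnerProductSpace.rankOne ℂ w (K.adjoint v) := by
  ext x
  simp [ContinuousLinearMap.adjoint_inner_left]

theorem adjoint_adjoint_mul_self (L : H →L[ℂ] H) :
    (L.adjoint * L).adjoint = L.adjoint * L := by
  rw [← ContinuousLinearMap.star_eq_adjoint, ← ContinuousLinearMap.star_eq_adjoint]
  simp

/-- The density operator of a functional `f` on the bounded operators: its matrix element between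
`v` and `w` is `f (|w⟩⟨v|)`. -/
noncomputable def densityOperator (f : (H →L[ℂ] H) →L[ℂ] ℂ) : H →L[ℂ] H :=
  (InnerProductSpace.continuousLinearMapOfBilin (𝕜 := ℂ)
    ((ContinuousLinearMap.compL ℂ H (H →L[ℂ] H) ℂ f).comp
      (InnerProductSpace.rankOne ℂ).flip)).adjoint

theorem inner_densityOperator (f : (H →L[ℂ] H) →L[ℂ] ℂ) (v w : H) :
    ⟪v, densityOperator f w⟫_ℂ = f (InnerProductSpace.rankOne ℂ w v) := by
  rw [densityOperator, ContinuousLinearMap.adjoint_inner_right,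
    InnerProductSpace.continuousLinearMapOfBilin_apply]
  rfl

theorem norm_densityOperator_le (f : (H →L[ℂ] H) →L[ℂ] ℂ) : ‖densityOperator f‖ ≤ 1 * ‖f‖ := by
  rw [one_mul]
  refine ContinuousLinearMap.opNorm_le_bound _ (norm_nonneg _) fun w => ?_
  rcases (norm_nonneg (densityOperator f w)).eq_or_lt with h | h
  · rw [← h]
    positivity
  · refine le_of_mul_le_mul_right ?_ h
    -- Testing against the image of w itself turns the matrix element into a squared norm.
    have h1 := inner_densityOperator f (densityOperator f w) w
    rw [inner_self_eq_norm_sq_to_K] at h1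
    have h2 := f.le_opNorm (InnerProductSpace.rankOne ℂ w (densityOperator f w))
    rw [← h1, InnerProductSpace.norm_rankOne, ← mul_assoc] at h2
    rw [← sq]
    simpa using h2

/-- The density operator as a bounded operator on functionals. -/
noncomputable def densityOperatorL : ((H →L[ℂ] H) →L[ℂ] ℂ) →L[ℂ] (H →L[ℂ] H) :=
  LinearMap.mkContinuous
    { toFun := densityOperator
      map_add' := fun f g => ext_inner_operator fun v w => by
        rw [add_apply, inner_add_right]
        simp only [inner_densityOperator, add_apply]
      map_smul' := fun c f => ext_inner_operator fun v w => by
        rw [smul_apply, inner_smul_right]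
        simp only [inner_densityOperator, smul_apply, RingHom.id_apply, smul_eq_mul] } 1
    norm_densityOperator_le

/-- Duality of the two pictures, without a trace: a factor on the left of |w⟩⟨v| moves to w and its
adjoint on the right to v, so every term becomes a matrix element of the density operator. -/
theorem densityOperator_comp_heisenbergGenerator {K : H →L[ℂ] H} (hK : IsSelfAdjoint K) (γ : ℝ)
    (L : H →L[ℂ] H) (f : (H →L[ℂ] H) →L[ℂ] ℂ) :
    densityOperator (f ∘L heisenbergGenerator γ L K) = lindbladian K γ L (densityOperator f) := by
  have hKsa := ContinuousLinearMap.isSelfAdjoint_iff'.mp hK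
  refine ext_inner_operator fun v w => ?_
  have h1 : ∀ x, ⟪v, K x⟫_ℂ = ⟪K v, x⟫_ℂ := fun x => by
    rw [← ContinuousLinearMap.adjoint_inner_right, hKsa]
  have h2 : ∀ x, ⟪v, (L.adjoint * L) x⟫_ℂ = ⟪(L.adjoint * L) v, x⟫_ℂ := fun x => by
    rw [← ContinuousLinearMap.adjoint_inner_right, adjoint_adjoint_mul_self]
  have h3 : ∀ x, ⟪v, L x⟫_ℂ = ⟪L.adjoint v, x⟫_ℂ := fun x =>
    (ContinuousLinearMap.adjoint_inner_left _ _ _).symm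
  have hl : lindbladian K γ L (densityOperator f) w =
      (-Complex.I) • (K (densityOperator f w) - densityOperator f (K w)) +
        (γ : ℂ) • (L (densityOperator f (L.adjoint w)) - (1 / 2 : ℂ) •
          ((L.adjoint * L) (densityOperator f w) + densityOperator f ((L.adjoint * L) w))) := rfl
  rw [inner_densityOperator, ContinuousLinearMap.comp_apply, heisenbergGenerator_apply, mul_rankOne,
    rankOne_mul, mul_rankOne, rankOne_mul, mul_rankOne, rankOne_mul, hKsa,
    adjoint_adjoint_mul_self, hl]
  simp only [inner_add_right, inner_sub_right, inner_smul_right, h1, h2, h3,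
    inner_densityOperator, map_add, map_sub, map_smul, smul_eq_mul]
  ring

theorem lindbladian_sub (K : H →L[ℂ] H) (γ : ℝ) (L ρ σ : H →L[ℂ] H) :
    lindbladian K γ L ρ - lindbladian K γ L σ = lindbladian K γ L (ρ - σ) := by
  simp only [lindbladian, mul_sub, sub_mul]
  module

theorem norm_lindbladian_le (K : H →L[ℂ] H) {γ : ℝ} (hγ : 0 ≤ γ) (L ρ : H →L[ℂ] H) :
    ‖lindbladian K γ L ρ‖ ≤ (2 * ‖K‖ + 2 * γ * ‖L‖ ^ 2) * ‖ρ‖ := by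
  have hLadj : ‖L.adjoint‖ = ‖L‖ := LinearIsometryEquiv.norm_map _ _
  have hLL : ‖L.adjoint * L‖ ≤ ‖L‖ ^ 2 := by
    refine (norm_mul_le _ _).trans (le_of_eq ?_)
    rw [hLadj, sq]
  have h1 : ‖K * ρ - ρ * K‖ ≤ 2 * ‖K‖ * ‖ρ‖ := by
    refine (norm_sub_le _ _).trans ?_
    linarith [norm_mul_le K ρ, norm_mul_le ρ K]
  have h2 : ‖L * ρ * L.adjoint‖ ≤ ‖L‖ ^ 2 * ‖ρ‖ := by
    calc _ ≤ ‖L‖ * ‖ρ‖ * ‖L.adjoint‖ := norm_mul₃_le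
      _ = _ := by rw [hLadj]; ring
  have h3 : ‖L.adjoint * L * ρ + ρ * (L.adjoint * L)‖ ≤ 2 * (‖L‖ ^ 2 * ‖ρ‖) := by
    refine (norm_add_le _ _).trans ?_
    have := norm_mul_le (L.adjoint * L) ρ
    have := norm_mul_le ρ (L.adjoint * L)
    have := mul_le_mul_of_nonneg_right hLL (norm_nonneg ρ)
    linarith
  have h4 : ‖(1 / 2 : ℂ) • (L.adjoint * L * ρ + ρ * (L.adjoint * L))‖ ≤ ‖L‖ ^ 2 * ‖ρ‖ := by
    rw [norm_smul, show ‖(1 / 2 : ℂ)‖ = 1 / 2 by simp]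
    linarith
  calc _ ≤ 2 * ‖K‖ * ‖ρ‖ + γ * (‖L‖ ^ 2 * ‖ρ‖ + ‖L‖ ^ 2 * ‖ρ‖) := by
        refine (norm_add_le _ _).trans (add_le_add ?_ ?_)
        · rwa [norm_smul, norm_neg, Complex.norm_I, one_mul]
        · rw [norm_smul, Complex.norm_real, Real.norm_of_nonneg hγ]
          gcongr
          exact (norm_sub_le _ _).trans (add_le_add h2 h4)
    _ = _ := by ring

/-- A solution of the Lindblad equation is determined by the dual evolution of functionals. -/
theorem apply_rankOne_eq_inner {K : ℝ → H →L[ℂ] H} (hK : ∀ t : ℝ, 0 ≤ t → IsSelfAdjoint (K t))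
    (hKc : ContinuousOn K (Set.Ici 0)) {γ : ℝ} (hγ : 0 ≤ γ) {L : H →L[ℂ] H} {ψ : H}
    {ρ : ℝ → H →L[ℂ] H} (hρ : IsLindbladSolution K γ L ψ ρ)
    {f : ℝ → (H →L[ℂ] H) →L[ℂ] ℂ} (hf0 : ∀ X, f 0 X = ⟪ψ, X ψ⟫_ℂ)
    (hf : ∀ t : ℝ, 0 ≤ t → HasDerivAt f (f t ∘L heisenbergGenerator γ L (K t)) t)
    {t : ℝ} (ht : 0 ≤ t) (v w : H) : f t (InnerProductSpace.rankOne ℂ w v) = ⟪v, ρ t w⟫_ℂ := by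
  obtain ⟨M, hM⟩ := (isCompact_Icc (a := 0) (b := t)).exists_bound_of_continuousOn
    (hKc.mono fun s hs => hs.1)
  have hderiv : ∀ s : ℝ, 0 ≤ s → HasDerivWithinAt (fun r => densityOperator (f r) - ρ r)
      (lindbladian (K s) γ L (densityOperator (f s) - ρ s)) (Set.Ici 0) s := by
    intro s hs
    have h1 := ((densityOperatorL (H := H)).restrictScalars ℝ).hasFDerivAt.comp_hasDerivAt s
      (hf s hs)
    refine (h1.hasDerivWithinAt.sub (hρ.2 s hs)).congr_deriv ?_
    rw [← lindbladian_sub, ← densityOperator_comp_heisenbergGenerator (hK s hs)]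
    rfl
  -- Grönwall for the difference, which solves the same linear equation with zero initial value. The
  -- operator norm suffices, so ρ need not be known to be of trace class.
  have h0 := eq_zero_of_abs_deriv_le_mul_abs_self_of_eq_zero_right
    (K := 2 * M + 2 * γ * ‖L‖ ^ 2)
    (fun s hs => ((hderiv s hs.1).mono Set.Icc_subset_Ici_self).continuousWithinAt)
    (fun s hs => (hderiv s hs.1).mono (Set.Ici_subset_Ici.mpr hs.1)) ?_
    (fun s hs => (norm_lindbladian_le _ hγ L _).trans ?_) t ⟨ht, le_rfl⟩
  · rw [← inner_densityOperator, sub_eq_zero.mp h0]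
  · refine sub_eq_zero.mpr (ext_inner_operator fun v w => ?_)
    rw [inner_densityOperator, hf0, hρ.1]
    simp [mul_comm]
  · have := hM s ⟨hs.1, hs.2.le⟩
    gcongr

end Identification

/-! ### The limit of short collisions. -/

section Limit

variable {H : Type*} [NormedAddCommGroup H] [InnerProductSpace ℂ H] [CompleteSpace H]

/-- The coefficients of the dual master equation for a functional `f`, together with
`q' = f (L† L)`. -/
noncomputable def flowGenerator (γ : ℝ) (L K : H →L[ℂ] H) :
    (((H →L[ℂ] H) →L[ℂ] ℂ) × ℂ) →L[ℂ] (((H →L[ℂ] H) →L[ℂ] ℂ) × ℂ) :=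
  ContinuousLinearMap.inl ℂ _ ℂ ∘L
      (ContinuousLinearMap.compL ℂ (H →L[ℂ] H) (H →L[ℂ] H) ℂ).flip (heisenbergGenerator γ L K) ∘L
        ContinuousLinearMap.fst ℂ _ _ +
    ContinuousLinearMap.inr ℂ _ ℂ ∘L ContinuousLinearMap.apply ℂ ℂ (L.adjoint * L) ∘L
      ContinuousLinearMap.fst ℂ _ _

theorem flowGenerator_apply (γ : ℝ) (L K : H →L[ℂ] H) (u : ((H →L[ℂ] H) →L[ℂ] ℂ) × ℂ) :
    flowGenerator γ L K u = (u.1 ∘L heisenbergGenerator γ L K, u.1 (L.adjoint * L)) :=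
  Prod.ext (add_zero _) (zero_add _)

theorem continuous_flowGenerator (γ : ℝ) (L : H →L[ℂ] H) : Continuous (flowGenerator γ L) := by
  have h : Continuous fun K =>
      (ContinuousLinearMap.compL ℂ (H →L[ℂ] H) (H →L[ℂ] H) ℂ).flip (heisenbergGenerator γ L K) :=
    (ContinuousLinearMap.continuous _).comp (continuous_heisenbergGenerator γ L)
  exact (continuous_const.clm_comp (h.clm_comp continuous_const)).add continuous_const

/-- Existence and Euler convergence are bundled so that both refer to the same solution;
complex-linear coefficients are handled by restricting scalars, time being real. -/
theorem exists_linear_ode_solution_complex {E : Type*} [NormedAddCommGroup E] [NormedSpace ℂ E]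
    [NormedSpace ℝ E] [IsScalarTower ℝ ℂ E] [CompleteSpace E] {A : ℝ → E →L[ℂ] E} (hA : Continuous A) (x₀ : E) :
    ∃ u : ℝ → E, u 0 = x₀ ∧ (∀ t, HasDerivAt u (A t (u t)) t) ∧
      ∀ (T : ℝ), 0 ≤ T → ∀ (g : ℕ → ℕ → E), (∀ n, g n 0 = x₀) → ∀ (η : ℕ → ℝ),
        Filter.Tendsto η Filter.atTop (nhds 0) →
        (∀ n i, i < n → ‖g n (i + 1) - g n i - (T / n) • A ((i + 1) * (T / n)) (g n i)‖ ≤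
          T / n * η n) → Filter.Tendsto (fun n => g n n) Filter.atTop (nhds (u T)) := by
  have hA' : Continuous fun t => (A t).restrictScalars ℝ :=
    (ContinuousLinearMap.restrictScalarsL ℂ E E ℝ ℝ).continuous.comp hA
  obtain ⟨u, hu0, hu⟩ := exists_linear_ode_solution hA' x₀
  exact ⟨u, hu0, hu, fun T hT g hg0 η hη hg =>
    euler_tendsto hA' hu hT g (fun n => (hg0 n).trans hu0.symm) hη hg⟩

/-- The states of the collision model converge to a solution of the dual master equation. -/
theorem exists_limit_flow {Hc : ℝ → H →L[ℂ] H} (hHc : ∀ t : ℝ, 0 ≤ t → IsSelfAdjoint (Hc t))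
    (hHc_cont : ContinuousOn Hc (Set.Ici 0)) {γ : ℝ} (hγ : 0 ≤ γ) (L : H →L[ℂ] H) {ψ : H}
    (hψ : ‖ψ‖ = 1) : ∃ (f : ℝ → (H →L[ℂ] H) →L[ℂ] ℂ) (q : ℝ → ℂ),
      (∀ X, f 0 X = ⟪ψ, X ψ⟫_ℂ) ∧ q 0 = 0 ∧
      (∀ t : ℝ, 0 ≤ t → HasDerivAt f (f t ∘L heisenbergGenerator γ L (Hc t)) t) ∧
      (∀ t : ℝ, HasDerivAt q (f t (L.adjoint * L)) t) ∧
      ∀ t : ℝ, 0 ≤ t →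
        Filter.Tendsto (fun n : ℕ => reducedState
          (jointEvolution n Hc γ L (t / n) n (lp.single 2 0 ψ))) Filter.atTop (nhds (f t)) ∧
        Filter.Tendsto (fun n : ℕ => ((t / n * ∑ l ∈ Finset.range n,
          ‖onSystem n L (jointEvolution n Hc γ L (t / n) l (lp.single 2 0 ψ))‖ ^ 2 : ℝ) : ℂ))
          Filter.atTop (nhds (q t)) := by
  -- Freezing the control at its initial value for negative times makes the coefficients continuous
  -- on the whole line, hence the derivatives two-sided even at 0.
  have hK : Continuous fun t : ℝ => Hc (max t 0) :=
    hHc_cont.comp_continuous (by fun_prop) fun t => le_max_right t 0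
  obtain ⟨u, hu0, hu, hlim⟩ := exists_linear_ode_solution_complex
    ((continuous_flowGenerator γ L).comp hK)
    -- The reduced initial state does not depend on the number of modes, so the chain with no modes
    -- represents it for every n.
    ((reducedState (lp.single 2 0 ψ : Joint H 0), 0) : ((H →L[ℂ] H) →L[ℂ] ℂ) × ℂ)
  refine ⟨fun t => (u t).1, fun t => (u t).2, fun X => ?_, ?_, fun t ht => ?_, fun t => ?_,
    fun t ht => ?_⟩
  · change (u 0).1 X = _
    rw [hu0, reducedState_single]
  · change (u 0).2 = 0
    rw [hu0]
  · have h := (hasFDerivAt_fst (𝕜 := ℝ) (p := u t)).comp_hasDerivAt t (hu t)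
    refine h.congr_deriv ?_
    rw [Function.comp_apply, max_eq_left ht, flowGenerator_apply]
    rfl
  · refine ((hasFDerivAt_snd (𝕜 := ℝ) (p := u t)).comp_hasDerivAt t (hu t)).congr_deriv ?_
    rw [Function.comp_apply, flowGenerator_apply]
    rfl
  · obtain ⟨M, hM⟩ := (isCompact_Icc (a := 0) (b := t)).exists_bound_of_continuousOn
      (hHc_cont.mono fun s hs => hs.1)
    obtain ⟨C, hC⟩ := exists_local_error γ hγ L M t
    set Φ : ∀ n : ℕ, ℕ → Joint H n := fun n i =>
      jointEvolution n Hc γ L (t / n) i (lp.single 2 0 ψ) with hΦ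
    have h := hlim t ht (fun n i => (reducedState (Φ n i),
      ((t / n * ∑ l ∈ Finset.range i, ‖onSystem n L (Φ n l)‖ ^ 2 : ℝ) : ℂ))) ?_
      (fun n => C * √(t / n)) ?_ ?_
    · exact ⟨(continuous_fst.tendsto _).comp h, (continuous_snd.tendsto _).comp h⟩
    · intro n
      refine Prod.ext (ContinuousLinearMap.ext fun X => ?_) (by simp)
      change reducedState (lp.single 2 0 ψ : Joint H n) X = _
      rw [reducedState_single, reducedState_single]
    · have h := (Real.continuous_sqrt.tendsto 0).comp (tendsto_const_div_atTop_nhds_zero_nat t)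
      simpa using h.const_mul C
    · intro n i hi
      have hn0 : (0 : ℝ) < n := by exact_mod_cast (by omega : 0 < n)
      set δ : ℝ := t / n with hδ
      have hδ0 : 0 ≤ δ := by positivity
      have hnδ : n * δ = t := by rw [hδ]; field_simp
      have hδt : δ ≤ t := by
        have : (1 : ℝ) ≤ n := by exact_mod_cast (by omega : 1 ≤ n)
        nlinarith
      have hτ0 : 0 ≤ ((i : ℝ) + 1) * δ := by positivity
      have hτt : ((i : ℝ) + 1) * δ ≤ t := by
        have : (i : ℝ) + 1 ≤ n := by exact_mod_cast hi
        rw [← hnδ]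
        gcongr
      have hloc := hC ⟨i, hi⟩ δ hδ0 hδt (Hc (((i : ℝ) + 1) * δ)) (hHc _ hτ0) (hM _ ⟨hτ0, hτt⟩)
        (Φ n i) (jointEvolution_mem_vacuumIn Hc L δ γ ψ hi.le _ le_rfl) (by
          rw [hΦ, norm_jointEvolution Hc L δ hHc hδ0 γ hi.le, lp.norm_single (by norm_num), hψ])
      rw [← jointEvolution_succ_apply Hc L δ γ hi] at hloc
      rw [Function.comp_apply, flowGenerator_apply, max_eq_left hτ0, Prod.norm_def]
      refine max_le hloc ?_
      -- In the second component the Riemann sum performs the Euler step without any error.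
      have hzero : ((δ * ∑ l ∈ Finset.range (i + 1), ‖onSystem n L (Φ n l)‖ ^ 2 : ℝ) : ℂ) -
          ((δ * ∑ l ∈ Finset.range i, ‖onSystem n L (Φ n l)‖ ^ 2 : ℝ) : ℂ) -
          δ • reducedState (Φ n i) (L.adjoint * L) = 0 := by
        rw [reducedState_adjoint_mul_self, Finset.sum_range_succ, Complex.real_smul]
        push_cast
        ring
      refine le_trans (le_of_eq ?_) ((norm_nonneg _).trans hloc)
      exact (congrArg norm hzero).trans norm_zero

end Limit

end Collisional

/-! ### The QFI flow, its trace formula and the linear bound. -/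

theorem lemma1 {H ι : Type*} [NormedAddCommGroup H] [InnerProductSpace ℂ H] [CompleteSpace H]
    (e : HilbertBasis ι ℂ H)
    (L : H →L[ℂ] H)
    (Hc : ℝ → H →L[ℂ] H) (hHc_sa : ∀ t : ℝ, 0 ≤ t → IsSelfAdjoint (Hc t))
    (hHc_cont : ContinuousOn Hc (Set.Ici 0))
    (γ : ℝ → ℝ) (hγ : ∀ x, 0 ≤ γ x)
    (θ : ℝ) (hγ_diff : DifferentiableAt ℝ (fun x => √(γ x)) θ)
    (ψ : H) (hψ : ‖ψ‖ = 1)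
    (ρ : ℝ → H →L[ℂ] H) (hρ : Collisional.IsLindbladSolution Hc (γ θ) L ψ ρ) :
    -- `L† L ρ(s)` has an absolutely convergent trace
    (∀ s : ℝ, 0 ≤ s → Summable fun i => ⟪e i, (L.adjoint * L * ρ s) (e i)⟫_ℂ) ∧
    ∃ F flow : ℝ → ℝ,
      -- `F t` is the QFI of the collisional purification at time `t`, in the limit of short collisions
      (∀ t : ℝ, 0 ≤ t → ∃ Fn : ℕ → ℝ,
        (∀ n : ℕ, Collisional.HasPureQFI
          (fun x => Collisional.purification Hc (γ x) L ψ t n) θ (Fn n)) ∧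
        Filter.Tendsto Fn Filter.atTop (nhds (F t))) ∧
      -- `flow` is the time derivative of `F`
      (∀ t : ℝ, 0 ≤ t → HasDerivWithinAt F (flow t) (Set.Ici 0) t) ∧
      (∀ s : ℝ, 0 ≤ s → (flow s : ℂ) =
        4 * ((deriv (fun x => √(γ x)) θ : ℝ) : ℂ) ^ 2 *
          Collisional.traceIn e (L.adjoint * L * ρ s)) ∧
      (∀ t : ℝ, 0 ≤ t → IntervalIntegrable flow MeasureTheory.volume 0 t ∧
        F t = ∫ s in (0 : ℝ)..t, flow s) ∧
      (∀ t : ℝ, 0 ≤ t →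
        F t ≤ 4 * t * (deriv (fun x => √(γ x)) θ) ^ 2 * ‖L‖ ^ 2) := by
  open Collisional in
  obtain ⟨f, q, hf0, hq0, hf, hq, hlim⟩ := exists_limit_flow hHc_sa hHc_cont (hγ θ) L hψ
  set d : ℝ := deriv (fun x => √(γ x)) θ with hd
  have hfc : ∀ s, 0 ≤ s → ContinuousAt f s := fun s hs => (hf s hs).continuousAt
  have hnormal : ∀ s, 0 ≤ s → IsNormalIn e (f s) := fun s hs =>
    IsNormalIn.of_tendsto (fun n => isNormalIn_reducedState e _) (hlim s hs).1
  have htrace : ∀ s, 0 ≤ s →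
      HasSum (fun i => ⟪e i, (L.adjoint * L * ρ s) (e i)⟫_ℂ) (f s (L.adjoint * L)) := by
    intro s hs
    -- Since L†L is self-adjoint, |e i⟩⟨e i| L†L = |e i⟩⟨L†L e i|; its value under f is a diagonal
    -- matrix element of L†L ρ, and normality sums these to f(L†L).
    have hterm : ∀ i, f s (InnerProductSpace.rankOne ℂ (e i) (e i) * (L.adjoint * L)) =
        ⟪e i, (L.adjoint * L * ρ s) (e i)⟫_ℂ := fun i => by
      rw [rankOne_mul, apply_rankOne_eq_inner hHc_sa hHc_cont (hγ θ) hρ hf0 hf hs,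
        ContinuousLinearMap.adjoint_inner_left]
      rfl
    simpa only [hterm] using hnormal s hs (L.adjoint * L)
  have hreal : ∀ s, 0 ≤ s → (f s (L.adjoint * L)).im = 0 := by
    intro s hs
    have h1 := (((ContinuousLinearMap.apply ℂ ℂ (L.adjoint * L)).continuous.tendsto _).comp
      (hlim s hs).1)
    have h2 := (Complex.continuous_im.tendsto _).comp h1
    refine tendsto_nhds_unique h2 (tendsto_const_nhds.congr fun n => ?_)
    change 0 = (reducedState _ (L.adjoint * L)).im
    rw [reducedState_adjoint_mul_self, Complex.ofReal_im]
  refine ⟨fun s hs => (htrace s hs).summable, fun t => 4 * (d ^ 2 * (q t).re),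
    fun t => 4 * (d ^ 2 * (f t (L.adjoint * L)).re), fun t ht => ?_, fun t ht => ?_,
    fun s hs => ?_, fun t ht => ?_, fun t ht => ?_⟩
  · refine ⟨_, fun n => hasPureQFI_purification Hc L hHc_sa hγ_diff.hasDerivAt ψ ht n, ?_⟩
    have h := (((Complex.continuous_re.tendsto _).comp (hlim t ht).2).const_mul (d ^ 2)).const_mul 4
    refine h.congr fun n => ?_
    rw [Function.comp_apply, Complex.ofReal_re, mul_assoc (d ^ 2)]
  · exact (((Complex.reCLM.hasFDerivAt.comp_hasDerivAt t (hq t)).const_mul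
      (d ^ 2)).const_mul 4).hasDerivWithinAt
  · rw [traceIn, (htrace s hs).tsum_eq]
    have : f s (L.adjoint * L) = ((f s (L.adjoint * L)).re : ℂ) :=
      Complex.ext rfl (by rw [hreal s hs, Complex.ofReal_im])
    rw [this]
    push_cast
    ring
  · have hcont : ContinuousOn (fun s => 4 * (d ^ 2 * (f s (L.adjoint * L)).re)) (Set.uIcc 0 t) := by
      rw [Set.uIcc_of_le ht]
      intro s hs
      have h := (ContinuousLinearMap.apply ℂ ℂ (L.adjoint * L)).continuous.continuousAt.comp
        (hfc s hs.1)
      exact ((((Complex.continuous_re.continuousAt.comp h).const_mul (d ^ 2)).const_mul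
        4)).continuousWithinAt
    refine ⟨hcont.intervalIntegrable, ?_⟩
    -- The derivative of q is two-sided at every real time, so the fundamental theorem applies up to
    -- the endpoint 0.
    have h := intervalIntegral.integral_eq_sub_of_hasDerivAt (fun s _ =>
      ((Complex.reCLM.hasFDerivAt.comp_hasDerivAt s (hq s)).const_mul (d ^ 2)).const_mul 4)
      hcont.intervalIntegrable
    refine Eq.trans ?_ h.symm
    simp [hq0]
  · have h := (((Complex.continuous_re.tendsto _).comp (hlim t ht).2).const_mul (d ^ 2)).const_mul 4
    -- The bound is proved before the limit, for n ≥ 1 so that n cancels in t / n * n.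
    refine le_of_tendsto h (Filter.eventually_atTop.mpr ⟨1, fun n hn => ?_⟩)
    have hn0 : (0 : ℝ) < n := by exact_mod_cast hn
    have hsum : ∑ l ∈ Finset.range n,
        ‖onSystem n L (jointEvolution n Hc (γ θ) L (t / n) l (lp.single 2 0 ψ))‖ ^ 2 ≤
          n * ‖L‖ ^ 2 := by
      refine (Finset.sum_le_card_nsmul _ _ (‖L‖ ^ 2) fun l hl => ?_).trans (by simp)
      gcongr
      refine (norm_onSystem_apply_le L _).trans ?_
      rw [norm_jointEvolution Hc L _ hHc_sa (by positivity) (γ θ) (Finset.mem_range.mp hl).le,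
        lp.norm_single (by norm_num), hψ, mul_one]
    rw [Function.comp_apply, Complex.ofReal_re]
    calc _ ≤ 4 * (d ^ 2 * (t / n * (n * ‖L‖ ^ 2))) := by gcongr
      _ = _ := by field_simp
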